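/- Let $k$ be a field, let $t\ge 2$, and let $\mathbf p=(p_1,\dots,p_t)$ be a sequence of integers $p_i\ge 1$. Let $\lambda_1,\dots,\lambda_t$ be pairwise distinct points of $\mathbb P^1(k)=k\cup\{\infty\}$, normalized so that $\lambda_1=\infty$, $\lambda_2=0$ and (if $t\ge 3$) $\lambda_3=1$. Let $L=L(\mathbf p)$ be the abelian group with generators $\vec x_1,\dots,\vec x_t$ and relations $p_1\vec x_1=\cdots=p_t\vec x_t$, and let $\pi_i\colon L\to\mathbb Z/p_i\mathbb Z$ be the homomorphism with $\pi_i(\vec x_j)=\delta_{ij}\bar 1$. Let $$S=k[X_1,\dots,X_t]\big/\big(X_i^{p_i}-(X_2^{p_2}-\lambda_iX_1^{p_1})\ :\ 3\le i\le t\big),$$ with the class of $X_i$ denoted by $x_i$, be the homogeneous coordinate algebra of the associated weighted projective line; it is $L$-graded by $\deg x_i=\vec x_i$. For a subgroup $H\subseteq L$ let $S_H=\bigoplus_{h\in H}S_h$, an $H$-graded algebra. Let $\mathrm{mod}^L\text{-}S$ be the abelian category of finitely presented $L$-graded $S$-modules (with degree-preserving homomorphisms), and let $\mathrm{qmod}^L\text{-}S$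 be its quotient by the Serre subcategory of finite dimensional modules, with quotient functor $q$; define $\mathrm{qmod}^H\text{-}S_H$ in the same way. The functor $M\mapsto M_H=\bigoplus_{h\in H}M_h$ from $\mathrm{mod}^L\text{-}S$ to $\mathrm{mod}^H\text{-}S_H$ induces the restriction functor $\mathrm{res}\colon \mathrm{qmod}^L\text{-}S\to\mathrm{qmod}^H\text{-}S_H$. Write $M(\vec x)$ for the shift $M(\vec x)_g=M_{\vec x+g}$ and put $\mathcal S_i(\vec x)=q\big((S/(x_i))(\vec x)\big)$. Let $\mathcal N_H$ be the smallest Serre subcategory of $\mathrm{qmod}^L\text{-}S$ containing all $\mathcal S_i(l\vec x_i)$ with $1\le i\le t$, $0\le l\le p_i-1$ and $-\bar l\notin\pi_i(H)$. Suppose that the subgroup $H$ of $L$ is infinite. Then $\mathrm{res}$ induces an equivalence of categories $$\mathrm{qmod}^L\text{-}S/\mathcal N_H\ \simeq\ \mathrm{qmod}^H\text{-}S_H .$$ Moreover, $\mathrm{res}\colon\mathrm{qmod}^L\text{-}S\to\mathrm{qmod}^H\text{-}S_H$ is itself an equivalence if and only if $H$ is effective, that is, $\pi_i(H)=\mathbb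 Z/p_i\mathbb Z$ for all $1\le i\le t$. -/

import Mathlib

open CategoryTheory CategoryTheory.Limits

universe u v

noncomputable section

/-! ## Direct sum decompositions of vector spaces -/

section Decomposition

variable {k : Type*} [Field k] {ι : Type*} {V : Type*} [AddCommGroup V] [Module k V]

/-- `V` is the (internal) direct sum of the subspaces `d i`. -/
def IsDirectSum (d : ι → Submodule k V) : Prop :=
  letI := Classical.decEq ι
  DirectSum.IsInternal d

/-- A family of subspaces which spans and which has projections is a direct sum decomposition. -/
theorem isDirectSum_of_proj {d : ι → Submodule k V} (π : ι → V →ₗ[k] V)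
    (h1 : ∀ i, ∀ m ∈ d i, π i m = m) (h2 : ∀ i j, i ≠ j → ∀ m ∈ d j, π i m = 0)
    (h3 : ∀ m, m ∈ ⨆ i, d i) : IsDirectSum d := by
  classical
  unfold IsDirectSum
  apply DirectSum.isInternal_submodule_of_iSupIndep_of_iSup_eq_top
  · rw [iSupIndep_def]
    intro i
    rw [Submodule.disjoint_def]
    intro x hx hx'
    rw [← h1 i x hx]
    have : (⨆ j, ⨆ (_ : j ≠ i), d j) ≤ LinearMap.ker (π i) := by
      refine iSup_le fun j => iSup_le fun hj => fun m hm => ?_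
      exact h2 i j (Ne.symm hj) m hm
    exact this hx'
  · exact eq_top_iff.2 fun m _ => h3 m

namespace IsDirectSum

variable {d : ι → Submodule k V} (h : IsDirectSum d)

/-- The projection of `V` onto its component `d i`. -/
def proj (i : ι) : V →ₗ[k] V :=
  letI := Classical.decEq ι
  (d i).subtype ∘ₗ DirectSum.component k ι (fun i => d i) i ∘ₗ
    (LinearEquiv.ofBijective (DirectSum.coeLinearMap d) h).symm.toLinearMap

theorem iSup_eq_top (h : IsDirectSum d) : ⨆ i, d i = ⊤ := by
  classical
  exact DirectSum.IsInternal.submodule_iSup_eq_top h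

theorem proj_mem (i : ι) (m : V) : h.proj i m ∈ d i := by
  classical
  simp [proj]

theorem proj_of_mem {i : ι} {m : V} (hm : m ∈ d i) : h.proj i m = m := by
  classical
  have := DirectSum.IsInternal.ofBijective_coeLinearMap_of_mem h hm
  exact congrArg Subtype.val this

theorem proj_of_mem_ne {i j : ι} (hij : i ≠ j) {m : V} (hm : m ∈ d j) : h.proj i m = 0 := by
  classical
  have := DirectSum.IsInternal.ofBijective_coeLinearMap_of_mem_ne h hij.symm hm
  exact congrArg Subtype.val this

/-- Every element lies in any subspace that contains all its components. -/
theorem mem_of_proj_mem (W : Submodule k V) (m : V) (hm : ∀ i, h.proj i m ∈ W) : m ∈ W := by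
  classical
  let e := LinearEquiv.ofBijective (DirectSum.coeLinearMap d) h
  have key : m = ∑ i ∈ (e.symm m).support, ((e.symm m i : d i) : V) := by
    conv_lhs => rw [← e.apply_symm_apply m]
    change DirectSum.coeLinearMap d (e.symm m) = _
    rw [DirectSum.coeLinearMap_eq_dfinsuppSum]
    rfl
  rw [key]
  exact W.sum_mem fun i _ => hm i

/-- A linear map that respects the decompositions commutes with the projections. -/
theorem map_proj {V' : Type*} [AddCommGroup V'] [Module k V'] {d' : ι → Submodule k V'}
    (h' : IsDirectSum d') (f : V →ₗ[k] V') (hf : ∀ i, ∀ m ∈ d i, f m ∈ d' i) (i : ι) (m : V) :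
    h'.proj i (f m) = f (h.proj i m) := by
  have hm : m ∈ ⨆ i, d i := by rw [h.iSup_eq_top]; trivial
  induction hm using Submodule.iSup_induction' with
  | mem j x hx =>
    by_cases hij : i = j
    · subst hij
      rw [h.proj_of_mem hx, h'.proj_of_mem (hf _ _ hx)]
    · rw [h.proj_of_mem_ne hij hx, h'.proj_of_mem_ne hij (hf _ _ hx), map_zero]
  | zero => simp
  | add x y _ _ hx hy => simp [hx, hy]

/-- A subspace which is stable under the projections inherits the decomposition. -/
theorem comap_subtype (W : Submodule k V) (hW : ∀ i, ∀ m ∈ W, h.proj i m ∈ W) :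
    IsDirectSum fun i => (d i).comap W.subtype := by
  refine isDirectSum_of_proj (fun i => (h.proj i).restrict (hW i)) ?_ ?_ ?_
  · intro i m hm
    exact Subtype.ext (h.proj_of_mem hm)
  · intro i j hij m hm
    exact Subtype.ext (h.proj_of_mem_ne hij hm)
  · intro m
    have : (m : V) ∈ (⨆ i, (d i).comap W.subtype).map W.subtype := by
      refine h.mem_of_proj_mem _ _ fun i => ?_
      refine ⟨⟨h.proj i m, hW i m m.2⟩, ?_, rfl⟩
      exact Submodule.mem_iSup_of_mem i (h.proj_mem i m)
    obtain ⟨x, hx, hxm⟩ := this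
    rwa [← show x = m from Subtype.ext hxm]

/-- The image of the decomposition under a surjection whose kernel is stable under the
projections is a decomposition. -/
theorem map_of_surjective (h : IsDirectSum d) {V' : Type*} [AddCommGroup V'] [Module k V'] (f : V →ₗ[k] V')
    (hf : Function.Surjective f) (hk : ∀ i m, f m = 0 → f (h.proj i m) = 0) :
    IsDirectSum fun i => (d i).map f := by
  have hker : ∀ i, LinearMap.ker f ≤ LinearMap.ker (f ∘ₗ h.proj i) := fun i m hm => hk i m hm
  let e := f.quotKerEquivOfSurjective hf
  let π : ι → V' →ₗ[k] V' := fun i =>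
    ((LinearMap.ker f).liftQ (f ∘ₗ h.proj i) (hker i)) ∘ₗ e.symm.toLinearMap
  have hπ : ∀ i m, π i (f m) = f (h.proj i m) := by
    intro i m
    have : e.symm (f m) = (LinearMap.ker f).mkQ m := by
      rw [LinearEquiv.symm_apply_eq]; rfl
    simp [π, this]
  refine isDirectSum_of_proj π ?_ ?_ ?_
  · rintro i _ ⟨m, hm, rfl⟩
    rw [hπ, h.proj_of_mem hm]
  · rintro i j hij _ ⟨m, hm, rfl⟩
    rw [hπ, h.proj_of_mem_ne hij hm, map_zero]
  · intro m
    obtain ⟨m, rfl⟩ := hf m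
    rw [← Submodule.map_iSup, h.iSup_eq_top]
    exact ⟨m, trivial, rfl⟩

theorem reindex (h : IsDirectSum d) {κ : Type*} (e : κ ≃ ι) : IsDirectSum fun j => d (e j) := by
  refine isDirectSum_of_proj (fun j => h.proj (e j)) (fun j m hm => h.proj_of_mem hm)
    (fun i j hij m hm => h.proj_of_mem_ne (e.injective.ne hij) hm) fun m => ?_
  rw [e.iSup_comp (g := d), h.iSup_eq_top]
  trivial

end IsDirectSum
end Decomposition

/-! ## Graded modules over a graded `k`-algebra -/

section GradedModules

variable {k A : Type u} [Field k] [CommRing A] [Algebra k A] {ι : Type v} [AddCommGroup ι]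

/-- An `ι`-graded module over a `k`-algebra `A` with homogeneous components `𝒜 i`:
an `A`-module with a decomposition `⨁ i, deg i` such that `𝒜 i • deg j ⊆ deg (i + j)`. -/
structure GrMod (𝒜 : ι → Submodule k A) where
  /-- the underlying module -/
  carrier : Type u
  [addCommGroup : AddCommGroup carrier]
  [moduleBase : Module k carrier]
  [module : Module A carrier]
  [isScalarTower : IsScalarTower k A carrier]
  /-- the homogeneous components -/
  deg : ι → Submodule k carrier
  isDirectSum : IsDirectSum deg
  smul_mem : ∀ {i j : ι} {a : A} {m : carrier}, a ∈ 𝒜 i → m ∈ deg j → a • m ∈ deg (i + j)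

namespace GrMod

attribute [instance] addCommGroup moduleBase module isScalarTower

variable {𝒜 : ι → Submodule k A}

/-- The degree preserving `A`-linear maps. -/
def homs (M N : GrMod 𝒜) : AddSubgroup (M.carrier →ₗ[A] N.carrier) where
  carrier := {f | ∀ i, ∀ m ∈ M.deg i, f m ∈ N.deg i}
  add_mem' hf hg i m hm := (N.deg i).add_mem (hf i m hm) (hg i m hm)
  zero_mem' i _ _ := (N.deg i).zero_mem
  neg_mem' hf i m hm := (N.deg i).neg_mem (hf i m hm)

instance : Category.{u} (GrMod 𝒜) where
  Hom M N := homs M N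
  id M := ⟨LinearMap.id, fun _ _ hm => hm⟩
  comp f g := ⟨g.1 ∘ₗ f.1, fun i m hm => g.2 i _ (f.2 i m hm)⟩

/-- The linear map underlying a morphism of graded modules. -/
def lin {M N : GrMod 𝒜} (f : M ⟶ N) : M.carrier →ₗ[A] N.carrier := f.1

/-- A degree preserving linear map as a morphism of graded modules. -/
def mkHom {M N : GrMod 𝒜} (f : M.carrier →ₗ[A] N.carrier)
    (hf : ∀ i, ∀ m ∈ M.deg i, f m ∈ N.deg i) : M ⟶ N := ⟨f, hf⟩

theorem lin_mem {M N : GrMod 𝒜} (f : M ⟶ N) {i : ι} {m : M.carrier} (hm : m ∈ M.deg i) :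
    lin f m ∈ N.deg i := f.2 i m hm

@[simp] theorem lin_mkHom {M N : GrMod 𝒜} (f : M.carrier →ₗ[A] N.carrier)
    (hf : ∀ i, ∀ m ∈ M.deg i, f m ∈ N.deg i) : lin (mkHom f hf) = f := rfl

@[simp] theorem lin_id (M : GrMod 𝒜) : lin (𝟙 M) = LinearMap.id := rfl

@[simp] theorem lin_comp {M N K : GrMod 𝒜} (f : M ⟶ N) (g : N ⟶ K) :
    lin (f ≫ g) = lin g ∘ₗ lin f := rfl

@[ext] theorem hom_ext {M N : GrMod 𝒜} {f g : M ⟶ N} (h : lin f = lin g) : f = g :=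
  Subtype.ext h

instance : Preadditive (GrMod 𝒜) where
  homGroup M N := inferInstanceAs (AddCommGroup (homs M N))
  add_comp _ _ _ f f' g := Subtype.ext (LinearMap.comp_add f.1 f'.1 g.1)
  comp_add _ _ _ f g g' := Subtype.ext (LinearMap.add_comp f.1 g'.1 g.1)

@[simp] theorem lin_zero {M N : GrMod 𝒜} : lin (0 : M ⟶ N) = 0 := rfl
@[simp] theorem lin_add {M N : GrMod 𝒜} (f g : M ⟶ N) : lin (f + g) = lin f + lin g := rfl

/-- The projection to the component of degree `i`. -/
def proj (M : GrMod 𝒜) (i : ι) : M.carrier →ₗ[k] M.carrier := M.isDirectSum.proj i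

theorem lin_proj {M N : GrMod 𝒜} (f : M ⟶ N) (i : ι) (m : M.carrier) :
    N.proj i (lin f m) = lin f (M.proj i m) :=
  M.isDirectSum.map_proj N.isDirectSum ((lin f).restrictScalars k)
    (fun _ _ hm => lin_mem f hm) i m

/-- The graded submodule given by a homogeneous submodule. -/
def sub (M : GrMod 𝒜) (N : Submodule A M.carrier) (hN : ∀ i, ∀ m ∈ N, M.proj i m ∈ N) :
    GrMod 𝒜 where
  carrier := N
  deg i := (M.deg i).comap ((N.subtype).restrictScalars k)
  isDirectSum := M.isDirectSum.comap_subtype (N.restrictScalars k) hN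
  smul_mem ha hm := M.smul_mem ha hm

/-- The graded quotient module by a homogeneous submodule. -/
def quotient (M : GrMod 𝒜) (N : Submodule A M.carrier) (hN : ∀ i, ∀ m ∈ N, M.proj i m ∈ N) :
    GrMod 𝒜 where
  carrier := M.carrier ⧸ N
  deg i := (M.deg i).map (N.mkQ.restrictScalars k)
  isDirectSum := M.isDirectSum.map_of_surjective (N.mkQ.restrictScalars k) N.mkQ_surjective
    fun i m hm => by
      have : m ∈ N := (Submodule.Quotient.mk_eq_zero N).1 hm
      exact (Submodule.Quotient.mk_eq_zero N).2 (hN i m this)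
  smul_mem := by
    rintro i j a _ ha ⟨m, hm, rfl⟩
    exact ⟨a • m, M.smul_mem ha hm, map_smul N.mkQ a m⟩

/-- The shifted module `M(x)`, with `M(x)_g = M_{x + g}`. -/
def shift (M : GrMod 𝒜) (x : ι) : GrMod 𝒜 where
  carrier := M.carrier
  deg g := M.deg (x + g)
  isDirectSum := M.isDirectSum.reindex (Equiv.addLeft x)
  smul_mem {i j a m} ha hm := by
    have := M.smul_mem ha hm
    rwa [show i + (x + j) = x + (i + j) by abel] at this

/-- The product of two graded modules. -/
def prod (M N : GrMod 𝒜) : GrMod 𝒜 where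
  carrier := M.carrier × N.carrier
  deg i := (M.deg i).prod (N.deg i)
  isDirectSum := by
    refine isDirectSum_of_proj (fun i => (M.proj i).prodMap (N.proj i)) ?_ ?_ ?_
    · rintro i ⟨m, n⟩ ⟨hm, hn⟩
      exact Prod.ext (M.isDirectSum.proj_of_mem hm) (N.isDirectSum.proj_of_mem hn)
    · rintro i j hij ⟨m, n⟩ ⟨hm, hn⟩
      exact Prod.ext (M.isDirectSum.proj_of_mem_ne hij hm) (N.isDirectSum.proj_of_mem_ne hij hn)
    · rintro ⟨m, n⟩
      have h1 : (m, (0 : N.carrier)) ∈ ⨆ i, (M.deg i).prod (N.deg i) := by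
        refine M.isDirectSum.mem_of_proj_mem
          ((⨆ i, (M.deg i).prod (N.deg i)).comap (LinearMap.inl k _ _)) m fun i => ?_
        exact Submodule.mem_iSup_of_mem i ⟨M.isDirectSum.proj_mem i m, (N.deg i).zero_mem⟩
      have h2 : ((0 : M.carrier), n) ∈ ⨆ i, (M.deg i).prod (N.deg i) := by
        refine N.isDirectSum.mem_of_proj_mem
          ((⨆ i, (M.deg i).prod (N.deg i)).comap (LinearMap.inr k _ _)) n fun i => ?_
        exact Submodule.mem_iSup_of_mem i ⟨(M.deg i).zero_mem, N.isDirectSum.proj_mem i n⟩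
      simpa using Submodule.add_mem _ h1 h2
  smul_mem ha hm := ⟨M.smul_mem ha hm.1, N.smul_mem ha hm.2⟩

variable (𝒜) in
/-- The zero graded module. -/
def zeroObj : GrMod 𝒜 where
  carrier := PUnit
  deg _ := ⊥
  isDirectSum := isDirectSum_of_proj (fun _ => 0) (fun _ _ _ => rfl) (fun _ _ _ _ _ => rfl)
    fun _ => Submodule.zero_mem _
  smul_mem _ _ := rfl

theorem ker_proj {M N : GrMod 𝒜} (f : M ⟶ N) :
    ∀ i, ∀ m ∈ LinearMap.ker (lin f), M.proj i m ∈ LinearMap.ker (lin f) := by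
  intro i m hm
  rw [LinearMap.mem_ker] at hm ⊢
  rw [← lin_proj, hm, map_zero]

theorem range_proj {M N : GrMod 𝒜} (f : M ⟶ N) :
    ∀ i, ∀ m ∈ LinearMap.range (lin f), N.proj i m ∈ LinearMap.range (lin f) := by
  rintro i _ ⟨m, rfl⟩
  exact ⟨M.proj i m, (lin_proj f i m).symm⟩

/-- The kernel of a morphism, as a graded submodule. -/
def ker {M N : GrMod 𝒜} (f : M ⟶ N) : GrMod 𝒜 := M.sub (LinearMap.ker (lin f)) (ker_proj f)

/-- The inclusion of the kernel. -/
def kerι {M N : GrMod 𝒜} (f : M ⟶ N) : ker f ⟶ M :=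
  mkHom (LinearMap.ker (lin f)).subtype fun _ _ hm => hm

/-- The cokernel of a morphism. -/
def coker {M N : GrMod 𝒜} (f : M ⟶ N) : GrMod 𝒜 :=
  N.quotient (LinearMap.range (lin f)) (range_proj f)

/-- The projection onto the cokernel. -/
def cokerπ {M N : GrMod 𝒜} (f : M ⟶ N) : N ⟶ coker f :=
  mkHom (LinearMap.range (lin f)).mkQ fun _ m hm => ⟨m, hm, rfl⟩

theorem kerι_comp {M N : GrMod 𝒜} (f : M ⟶ N) : kerι f ≫ f = 0 :=
  hom_ext (LinearMap.ext fun m => m.2)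

theorem comp_cokerπ {M N : GrMod 𝒜} (f : M ⟶ N) : f ≫ cokerπ f = 0 :=
  hom_ext (LinearMap.range_mkQ_comp (lin f))

/-- `ker f` is the kernel of `f`. -/
def kerIsLimit {M N : GrMod 𝒜} (f : M ⟶ N) :
    IsLimit (KernelFork.ofι (kerι f) (kerι_comp f)) :=
  KernelFork.IsLimit.ofι _ _
    (fun g hg => mkHom ((lin g).codRestrict _ fun m =>
        LinearMap.congr_fun (congrArg lin hg) m) fun _ _ hm => lin_mem g hm)
    (fun _ _ => rfl)
    (fun _ _ _ hm => hom_ext <| LinearMap.ext fun w => Subtype.ext <|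
      LinearMap.congr_fun (congrArg lin hm) w)

/-- `coker f` is the cokernel of `f`. -/
def cokerIsColimit {M N : GrMod 𝒜} (f : M ⟶ N) :
    IsColimit (CokernelCofork.ofπ (cokerπ f) (comp_cokerπ f)) :=
  CokernelCofork.IsColimit.ofπ _ _
    (fun g hg => mkHom ((LinearMap.range (lin f)).liftQ (lin g) (by
        rintro _ ⟨m, rfl⟩
        exact LinearMap.congr_fun (congrArg lin hg) m)) (by
        rintro i _ ⟨m, hm, rfl⟩
        exact lin_mem g hm))
    (fun _ _ => rfl)
    (fun _ _ _ hm => hom_ext <| LinearMap.ext fun w => by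
      obtain ⟨w, rfl⟩ := Submodule.mkQ_surjective _ w
      exact LinearMap.congr_fun (congrArg lin hm) w)

instance : HasKernels (GrMod 𝒜) where
  has_limit f := ⟨_, kerIsLimit f⟩

instance : HasCokernels (GrMod 𝒜) where
  has_colimit f := ⟨_, cokerIsColimit f⟩

theorem isZero_zeroObj : IsZero (zeroObj 𝒜) := by
  rw [IsZero.iff_id_eq_zero]
  exact hom_ext (LinearMap.ext fun _ => rfl)

instance : HasZeroObject (GrMod 𝒜) := ⟨_, isZero_zeroObj⟩

instance : HasBinaryProducts (GrMod 𝒜) :=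
  have : ∀ M N : GrMod 𝒜, HasLimit (pair M N) := fun M N =>
    ⟨⟨BinaryFan.mk (P := prod M N)
      (mkHom (LinearMap.fst A _ _) fun _ _ hm => hm.1)
      (mkHom (LinearMap.snd A _ _) fun _ _ hm => hm.2),
    BinaryFan.IsLimit.mk _
      (fun f g => mkHom ((lin f).prod (lin g)) fun _ _ hm => ⟨lin_mem f hm, lin_mem g hm⟩)
      (fun _ _ => rfl) (fun _ _ => rfl)
      (fun _ _ _ h1 h2 => hom_ext <| LinearMap.ext fun x => Prod.ext
        (LinearMap.congr_fun (congrArg lin h1) x) (LinearMap.congr_fun (congrArg lin h2) x))⟩⟩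
  hasBinaryProducts_of_hasLimit_pair _

instance : HasFiniteProducts (GrMod 𝒜) :=
  have : HasTerminal (GrMod 𝒜) := isZero_zeroObj.isTerminal.hasTerminal
  hasFiniteProducts_of_has_binary_and_terminal

theorem mono_iff {M N : GrMod 𝒜} (f : M ⟶ N) : Mono f ↔ Function.Injective (lin f) := by
  constructor
  · intro _
    have h : kerι f = 0 := zero_of_comp_mono f (kerι_comp f)
    rw [← LinearMap.ker_eq_bot, Submodule.eq_bot_iff]
    intro x hx
    exact LinearMap.congr_fun (congrArg lin h) ⟨x, hx⟩
  · intro hf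
    exact ⟨fun g h hgh => hom_ext <| LinearMap.ext fun x =>
      hf (LinearMap.congr_fun (congrArg lin hgh) x)⟩

theorem epi_iff {M N : GrMod 𝒜} (f : M ⟶ N) : Epi f ↔ Function.Surjective (lin f) := by
  constructor
  · intro _
    have h : cokerπ f = 0 := zero_of_epi_comp f (comp_cokerπ f)
    rw [← LinearMap.range_eq_top, eq_top_iff]
    intro x _
    exact (Submodule.Quotient.mk_eq_zero _).1 (LinearMap.congr_fun (congrArg lin h) x)
  · intro hf
    exact ⟨fun g h hgh => hom_ext <| LinearMap.ext fun x => by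
      obtain ⟨x, rfl⟩ := hf x
      exact LinearMap.congr_fun (congrArg lin hgh) x⟩

/-- A bijective morphism of graded modules is an isomorphism. -/
theorem isIso_of_bijective {M N : GrMod 𝒜} (f : M ⟶ N) (hf : Function.Bijective (lin f)) :
    IsIso f := by
  let e := LinearEquiv.ofBijective (lin f) hf
  refine ⟨mkHom e.symm.toLinearMap ?_, ?_, ?_⟩
  · intro i n hn
    obtain ⟨m, rfl⟩ := hf.2 n
    have h1 : e.symm (lin f m) = m := e.symm_apply_apply m
    change e.symm (lin f m) ∈ M.deg i
    have h2 : M.proj i m = m := by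
      apply hf.1
      rw [← lin_proj]
      exact N.isDirectSum.proj_of_mem hn
    rw [h1, ← h2]
    exact M.isDirectSum.proj_mem i m
  · exact hom_ext <| LinearMap.ext fun m => e.symm_apply_apply m
  · exact hom_ext <| LinearMap.ext fun m => e.apply_symm_apply m

/-- The category of graded modules is abelian. -/
instance : Abelian (GrMod 𝒜) where
  normalMonoOfMono {M N} f hf := by
    rw [mono_iff] at hf
    refine ⟨⟨coker f, cokerπ f, comp_cokerπ f, ?_⟩⟩
    let e : M ⟶ ker (cokerπ f) := mkHom ((lin f).codRestrict (LinearMap.ker (lin (cokerπ f)))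
        fun m => LinearMap.congr_fun (congrArg lin (comp_cokerπ f)) m)
        fun _ _ hm => lin_mem f hm
    have : IsIso e := by
      apply isIso_of_bijective
      constructor
      · intro x y hxy
        exact hf (congrArg Subtype.val hxy)
      · rintro ⟨y, hy⟩
        obtain ⟨x, hx⟩ := (Submodule.Quotient.mk_eq_zero _).1 hy
        exact ⟨x, Subtype.ext hx⟩
    exact IsLimit.ofIsoLimit (kerIsLimit (cokerπ f)) (Fork.ext (asIso e).symm (by
      rw [Iso.symm_hom, Iso.inv_comp_eq]
      rfl))
  normalEpiOfEpi {M N} f hf := by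
    rw [epi_iff] at hf
    refine ⟨⟨ker f, kerι f, kerι_comp f, ?_⟩⟩
    have hle : LinearMap.range (lin (kerι f)) ≤ LinearMap.ker (lin f) := by
      rintro _ ⟨m, rfl⟩
      exact m.2
    let e : coker (kerι f) ⟶ N := mkHom ((LinearMap.range (lin (kerι f))).liftQ (lin f) hle) (by
      rintro i _ ⟨m, hm, rfl⟩
      exact lin_mem f hm)
    have : IsIso e := by
      apply isIso_of_bijective
      constructor
      · rw [← LinearMap.ker_eq_bot, Submodule.eq_bot_iff]
        intro x hx
        obtain ⟨x, rfl⟩ := Submodule.mkQ_surjective _ x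
        exact (Submodule.Quotient.mk_eq_zero _).2 ⟨⟨x, hx⟩, rfl⟩
      · intro y
        obtain ⟨x, rfl⟩ := hf y
        exact ⟨Submodule.mkQ _ x, rfl⟩
    exact IsColimit.ofIsoColimit (cokerIsColimit (kerι f)) (Cofork.ext (asIso e) (by rfl))

theorem exact_of_shortExact {S : ShortComplex (GrMod 𝒜)} (hS : S.ShortExact) :
    LinearMap.range (lin S.f) = LinearMap.ker (lin S.g) := by
  apply le_antisymm
  · rintro _ ⟨m, rfl⟩
    exact LinearMap.congr_fun (congrArg lin S.zero) m
  · intro m hm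
    have := hS.mono_f
    obtain ⟨l, hl⟩ := KernelFork.IsLimit.lift' hS.exact.fIsKernel (kerι S.g) (kerι_comp S.g)
    exact ⟨lin l ⟨m, hm⟩, LinearMap.congr_fun (congrArg lin hl) ⟨m, hm⟩⟩

end GrMod

open GrMod

variable (𝒜 : ι → Submodule k A)

/-- The finitely presented graded modules. -/
def isFinPres : ObjectProperty (GrMod 𝒜) := fun M => Module.FinitePresentation A M.carrier

/-- The finite dimensional graded modules. -/
def isFinDim : ObjectProperty (GrMod 𝒜) := fun M => Module.Finite k M.carrier

instance : (isFinDim 𝒜).IsSerreClass where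
  exists_zero := ⟨zeroObj 𝒜, isZero_zeroObj, inferInstanceAs (Module.Finite k PUnit.{u+1})⟩
  prop_of_mono {X Y} f hf hY := by
    rw [mono_iff] at hf
    have : Module.Finite k Y.carrier := hY
    exact Module.Finite.of_injective ((lin f).restrictScalars k) hf
  prop_of_epi {X Y} f hf hX := by
    rw [epi_iff] at hf
    have : Module.Finite k X.carrier := hX
    exact Module.Finite.of_surjective ((lin f).restrictScalars k) hf
  prop_X₂_of_shortExact {S} hS h₁ h₃ := by
    have : Module.Finite k S.X₁.carrier := h₁
    have : Module.Finite k S.X₃.carrier := h₃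
    have h := exact_of_shortExact hS
    have : IsNoetherian k S.X₂.carrier :=
      isNoetherian_of_range_eq_ker ((lin S.f).restrictScalars k) ((lin S.g).restrictScalars k) (by
        ext x
        exact SetLike.ext_iff.1 h x)
    exact (inferInstance : Module.Finite k S.X₂.carrier)

instance [IsNoetherianRing A] : (isFinPres 𝒜).IsSerreClass where
  exists_zero := ⟨zeroObj 𝒜, isZero_zeroObj, (Module.finitePresentation_iff_finite _ _).2
    (inferInstanceAs (Module.Finite A PUnit.{u+1}))⟩
  prop_of_mono {X Y} f hf hY := by
    rw [mono_iff] at hf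
    have : Module.FinitePresentation A Y.carrier := hY
    exact (Module.finitePresentation_iff_finite _ _).2 (Module.Finite.of_injective (lin f) hf)
  prop_of_epi {X Y} f hf hX := by
    rw [epi_iff] at hf
    have : Module.FinitePresentation A X.carrier := hX
    exact (Module.finitePresentation_iff_finite _ _).2 (Module.Finite.of_surjective (lin f) hf)
  prop_X₂_of_shortExact {S} hS h₁ h₃ := by
    have : Module.FinitePresentation A S.X₁.carrier := h₁
    have : Module.FinitePresentation A S.X₃.carrier := h₃
    have : IsNoetherian A S.X₂.carrier :=
      isNoetherian_of_range_eq_ker (lin S.f) (lin S.g) (exact_of_shortExact hS)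
    exact (Module.finitePresentation_iff_finite _ _).2 inferInstance

instance [IsNoetherianRing A] : (isFinPres 𝒜).IsClosedUnderFiniteProducts :=
  have : (isFinPres 𝒜).IsClosedUnderBinaryProducts := ⟨by
    rintro X ⟨p⟩
    have : HasBinaryBiproducts (GrMod 𝒜) := HasBinaryBiproducts.of_hasBinaryProducts
    have h1 := (isFinPres 𝒜).prop_biprod (p.prop_diag_obj ⟨.left⟩) (p.prop_diag_obj ⟨.right⟩)
    refine (isFinPres 𝒜).prop_of_iso ?_ h1
    exact (biprod.isoProd _ _) ≪≫ (HasLimit.isoOfNatIso (diagramIsoPair p.diag)).symm ≪≫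
      (IsLimit.conePointUniqueUpToIso (limit.isLimit _) p.isLimit)⟩
  ObjectProperty.IsClosedUnderFiniteProducts.mk'

/-- The category of finitely presented graded modules. -/
abbrev GrModFP := (isFinPres 𝒜).FullSubcategory

instance [IsNoetherianRing A] : PreservesFiniteLimits (isFinPres 𝒜).ι :=
  have := fun {X Y : GrModFP 𝒜} (f : X ⟶ Y) => (isFinPres 𝒜).preservesKernels_ι f
  Functor.preservesFiniteLimits_of_preservesKernels _

instance [IsNoetherianRing A] : PreservesFiniteColimits (isFinPres 𝒜).ι :=
  have := fun {X Y : GrModFP 𝒜} (f : X ⟶ Y) => (isFinPres 𝒜).preservesCokernels_ι f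
  Functor.preservesFiniteColimits_of_preservesCokernels _

/-- The Serre subcategory of finite dimensional modules in the category of finitely presented
graded modules. -/
def finDimFP : ObjectProperty (GrModFP 𝒜) := (isFinDim 𝒜).inverseImage (isFinPres 𝒜).ι

instance [IsNoetherianRing A] : (finDimFP 𝒜).IsSerreClass :=
  inferInstanceAs ((isFinDim 𝒜).inverseImage (isFinPres 𝒜).ι).IsSerreClass

section Quotient

variable [IsNoetherianRing A]

/-- The quotient abelian category of the finitely presented graded modules by the Serre
subcategory of the finite dimensional ones. -/
abbrev QMod := (finDimFP 𝒜).isoModSerre.Localization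

/-- The quotient functor. -/
abbrev qFunctor : GrModFP 𝒜 ⥤ QMod 𝒜 := (finDimFP 𝒜).isoModSerre.Q

instance : Abelian (QMod 𝒜) :=
  ObjectProperty.SerreClassLocalization.abelian (qFunctor 𝒜) (finDimFP 𝒜)

variable {𝒜} in
theorem isoModSerre_finDimFP_iff {M N : GrModFP 𝒜} (f : M ⟶ N) :
    (finDimFP 𝒜).isoModSerre f ↔ isFinDim 𝒜 (GrMod.ker f.hom) ∧
      isFinDim 𝒜 (GrMod.coker f.hom) := by
  have h1 := (isFinPres 𝒜).preservesKernels_ι f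
  have h2 := (isFinPres 𝒜).preservesCokernels_ι f
  rw [ObjectProperty.isoModSerre_iff, ObjectProperty.monoModSerre_iff,
    ObjectProperty.epiModSerre_iff]
  refine and_congr ?_ ?_
  · exact (isFinDim 𝒜).prop_iff_of_iso ((PreservesKernel.iso (isFinPres 𝒜).ι f) ≪≫
      IsLimit.conePointUniqueUpToIso (limit.isLimit _) (GrMod.kerIsLimit f.hom))
  · exact (isFinDim 𝒜).prop_iff_of_iso ((PreservesCokernel.iso (isFinPres 𝒜).ι f) ≪≫
      IsColimit.coconePointUniqueUpToIso (colimit.isColimit _) (GrMod.cokerIsColimit f.hom))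

end Quotient

/-! ## Restriction to a subgroup of the grading group -/

section Restriction

/-- `A` is a graded algebra with homogeneous components `𝒜 i`. -/
class IsGradedAlgebra : Prop extends SetLike.GradedMonoid 𝒜 where
  isDirectSum : IsDirectSum 𝒜

variable (H : AddSubgroup ι)

section

variable {V : Type*} [AddCommGroup V] [Module k V] {d : ι → Submodule k V}

variable (d) in
/-- The part `⨁_{h ∈ H} d h`. -/
def partIn : Submodule k V := ⨆ h : H, d h

namespace IsDirectSum

variable (h : IsDirectSum d)

open Classical in
/-- The projection onto `⨁_{h ∈ H} d h`. -/
def projIn : V →ₗ[k] V :=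
  (DirectSum.toModule k ι V fun i => if i ∈ H then (d i).subtype else 0) ∘ₗ
    (LinearEquiv.ofBijective (DirectSum.coeLinearMap d) h).symm.toLinearMap

open Classical in
theorem projIn_of_mem {i : ι} {m : V} (hm : m ∈ d i) :
    h.projIn H m = if i ∈ H then m else 0 := by
  have : (LinearEquiv.ofBijective (DirectSum.coeLinearMap d) h).symm m =
      DirectSum.lof k ι (fun i => d i) i ⟨m, hm⟩ := by
    rw [LinearEquiv.symm_apply_eq]
    exact (DirectSum.coeLinearMap_lof d i ⟨m, hm⟩).symm
  simp only [projIn, LinearMap.comp_apply, LinearEquiv.coe_coe, this, DirectSum.toModule_lof]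
  split_ifs <;> rfl

theorem projIn_of_mem_partIn {m : V} (hm : m ∈ partIn H d) : h.projIn H m = m := by
  classical
  induction hm using Submodule.iSup_induction' with
  | mem j x hx => rw [h.projIn_of_mem H hx, if_pos j.2]
  | zero => simp
  | add x y _ _ hx hy => simp [hx, hy]

theorem projIn_mem (m : V) : h.projIn H m ∈ partIn H d := by
  classical
  have hm : m ∈ ⨆ i, d i := by rw [h.iSup_eq_top]; trivial
  induction hm using Submodule.iSup_induction' with
  | mem j x hx =>
    rw [h.projIn_of_mem H hx]
    split_ifs with hj
    · exact Submodule.mem_iSup_of_mem (⟨j, hj⟩ : H) hx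
    · exact Submodule.zero_mem _
  | zero => simp
  | add x y _ _ hx hy => rw [map_add]; exact Submodule.add_mem _ hx hy

theorem map_projIn {V' : Type*} [AddCommGroup V'] [Module k V'] {d' : ι → Submodule k V'}
    (h' : IsDirectSum d') (f : V →ₗ[k] V') (hf : ∀ i, ∀ m ∈ d i, f m ∈ d' i) (m : V) :
    h'.projIn H (f m) = f (h.projIn H m) := by
  classical
  have hm : m ∈ ⨆ i, d i := by rw [h.iSup_eq_top]; trivial
  induction hm using Submodule.iSup_induction' with
  | mem j x hx =>
    rw [h.projIn_of_mem H hx, h'.projIn_of_mem H (hf _ _ hx)]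
    split_ifs <;> simp
  | zero => simp
  | add x y _ _ hx hy => simp [hx, hy]

theorem partIn_isDirectSum (h : IsDirectSum d) :
    IsDirectSum fun i : H => (d i).comap (partIn H d).subtype := by
  have hle : ∀ i : H, d i ≤ partIn H d := le_iSup fun i : H => d i
  refine isDirectSum_of_proj
    (fun i => ((h.proj i) ∘ₗ (partIn H d).subtype).codRestrict _
      fun m => hle i (h.proj_mem i m)) ?_ ?_ ?_
  · intro i m hm
    exact Subtype.ext (h.proj_of_mem hm)
  · intro i j hij m hm
    exact Subtype.ext (h.proj_of_mem_ne (fun e => hij (Subtype.ext e)) hm)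
  · rintro ⟨m, hm⟩
    have hm' := hm
    change m ∈ ⨆ h : H, d h at hm'
    have : m ∈ (⨆ i : H, (d i).comap (partIn H d).subtype).map (partIn H d).subtype := by
      rw [Submodule.map_iSup]
      refine (iSup_mono fun i => ?_ : (⨆ h : H, d h) ≤ _) hm'
      intro x hx
      exact ⟨⟨x, hle i hx⟩, hx, rfl⟩
    obtain ⟨x, hx, rfl⟩ := this
    exact hx

end IsDirectSum
end

section

variable [SetLike.GradedMonoid 𝒜]

/-- The restriction subalgebra `A_H = ⨁_{h ∈ H} A_h`. -/
def restrAlg : Subalgebra k A where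
  carrier := partIn H 𝒜
  mul_mem' {a b} ha hb := by
    refine Submodule.iSup_induction (fun h : H => 𝒜 h) (motive := fun a => a * b ∈ partIn H 𝒜)
      ha ?_ ?_ ?_
    · intro i x hx
      refine Submodule.iSup_induction (fun h : H => 𝒜 h)
        (motive := fun b => x * b ∈ partIn H 𝒜) hb ?_ ?_ ?_
      · intro j y hy
        exact Submodule.mem_iSup_of_mem (i + j) (SetLike.mul_mem_graded hx hy)
      · simp
      · intro y z hy hz
        rw [mul_add]
        exact Submodule.add_mem _ hy hz
    · simp
    · intro y z hy hz
      rw [add_mul]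
      exact Submodule.add_mem _ hy hz
  add_mem' ha hb := Submodule.add_mem _ ha hb
  algebraMap_mem' r := by
    have : (1 : A) ∈ partIn H 𝒜 := Submodule.mem_iSup_of_mem 0 (SetLike.one_mem_graded 𝒜)
    rw [Algebra.algebraMap_eq_smul_one]
    exact Submodule.smul_mem _ r this

/-- The `H`-grading of the restriction subalgebra. -/
def restrGrading : H → Submodule k (restrAlg 𝒜 H) :=
  fun h => (𝒜 h).comap (restrAlg 𝒜 H).val.toLinearMap

end

variable [IsGradedAlgebra 𝒜]

instance : IsGradedAlgebra (restrGrading 𝒜 H) where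
  one_mem := SetLike.one_mem_graded 𝒜
  mul_mem _ _ _ _ hx hy := SetLike.mul_mem_graded (A := 𝒜) hx hy
  isDirectSum := (IsGradedAlgebra.isDirectSum (𝒜 := 𝒜)).partIn_isDirectSum H

/-- A module over `B` that is a retract (in a suitable sense) of a Noetherian module over an
overring `A` is Noetherian. -/
theorem isNoetherian_of_retract {B N X : Type*} [CommRing B] [Algebra B A] [AddCommGroup N]
    [Module B N] [AddCommGroup X] [Module A X] [Module B X] [IsScalarTower B A X]
    [IsNoetherian A X] (i : N →ₗ[B] X) (p : X →+ N) (q : A → B)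
    (hpi : ∀ n, p (i n) = n) (hp : ∀ a n, p (a • i n) = q a • n) : IsNoetherian B N := by
  let Φ : Submodule B N → Submodule A X := fun N' => Submodule.span A (i '' N')
  have hΦ : ∀ (N' : Submodule B N) (n : N), n ∈ N' ↔ i n ∈ Φ N' := by
    intro N' n
    constructor
    · intro hn
      exact Submodule.subset_span ⟨n, hn, rfl⟩
    · intro hn
      rw [← hpi n]
      refine Submodule.span_induction (p := fun x _ => p x ∈ N') ?_ ?_ ?_ ?_ hn
      · rintro _ ⟨n, hn, rfl⟩
        rwa [hpi]
      · simp
      · intro x y _ _ hx hy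
        rw [map_add]
        exact N'.add_mem hx hy
      · intro a x hx _
        refine Submodule.span_induction (p := fun x _ => ∀ a : A, p (a • x) ∈ N')
          ?_ ?_ ?_ ?_ hx a
        · rintro _ ⟨n, hn, rfl⟩ a
          rw [hp]
          exact N'.smul_mem _ hn
        · simp
        · intro x y _ _ hx hy a
          rw [smul_add, map_add]
          exact N'.add_mem (hx a) (hy a)
        · intro b x _ hx a
          rw [smul_smul]
          exact hx _
  have hmono : StrictMono Φ := by
    refine Monotone.strictMono_of_injective ?_ ?_
    · intro N₁ N₂ h
      exact Submodule.span_mono (Set.image_mono h)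
    · intro N₁ N₂ h
      ext n
      rw [hΦ, hΦ, h]
  rw [isNoetherian_iff']
  exact hmono.wellFoundedGT

/-- `A` as a graded module over itself. -/
def GrMod.self : GrMod 𝒜 where
  carrier := A
  deg := 𝒜
  isDirectSum := IsGradedAlgebra.isDirectSum
  smul_mem ha hm := SetLike.mul_mem_graded ha hm

variable {𝒜}

theorem projIn_smul (M : GrMod 𝒜) (a : A) (n : M.carrier) (hn : n ∈ partIn H M.deg) :
    M.isDirectSum.projIn H (a • n) =
      (IsGradedAlgebra.isDirectSum (𝒜 := 𝒜)).projIn H a • n := by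
  classical
  have hd := IsGradedAlgebra.isDirectSum (𝒜 := 𝒜)
  have ha : a ∈ ⨆ i, 𝒜 i := by rw [hd.iSup_eq_top]; trivial
  refine Submodule.iSup_induction (fun h : H => M.deg h)
    (motive := fun n => M.isDirectSum.projIn H (a • n) = hd.projIn H a • n) hn ?_ ?_ ?_
  · intro j n hn
    refine Submodule.iSup_induction 𝒜
      (motive := fun a => M.isDirectSum.projIn H (a • n) = hd.projIn H a • n) ha ?_ ?_ ?_
    · intro i a ha
      rw [hd.projIn_of_mem H ha, M.isDirectSum.projIn_of_mem H (M.smul_mem ha hn)]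
      have : i + j ∈ H ↔ i ∈ H := H.add_mem_cancel_right j.2
      by_cases hi : i ∈ H
      · rw [if_pos hi, if_pos (this.2 hi)]
      · rw [if_neg hi, if_neg (fun h => hi (this.1 h)), zero_smul]
    · simp
    · intro x y hx hy
      rw [add_smul, map_add, map_add, hx, hy, add_smul]
  · simp
  · intro x y hx hy
    rw [smul_add, map_add, hx, hy, smul_add]

instance [IsNoetherianRing A] : IsNoetherianRing (restrAlg 𝒜 H) := by
  have hd := IsGradedAlgebra.isDirectSum (𝒜 := 𝒜)
  let P : A →+ restrAlg 𝒜 H :=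
    ((hd.projIn H).codRestrict (partIn H 𝒜) (hd.projIn_mem H)).toAddMonoidHom
  refine isNoetherian_of_retract (A := A) (X := A)
    (Algebra.linearMap (restrAlg 𝒜 H) A) P P ?_ ?_
  · intro n
    exact Subtype.ext (hd.projIn_of_mem_partIn H n.2)
  · intro a n
    exact Subtype.ext (projIn_smul H (GrMod.self 𝒜) a n.1 n.2)

/-- The ideal generated by a homogeneous element is homogeneous. -/
theorem span_singleton_proj {j : ι} {a : A} (ha : a ∈ 𝒜 j) :
    ∀ i, ∀ m ∈ (Submodule.span A {a} : Submodule A A),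
      (IsGradedAlgebra.isDirectSum (𝒜 := 𝒜)).proj i m ∈ (Submodule.span A {a} : Submodule A A) := by
  classical
  have hd := IsGradedAlgebra.isDirectSum (𝒜 := 𝒜)
  intro i m hm
  obtain ⟨b, rfl⟩ := Submodule.mem_span_singleton.1 hm
  have hb : b ∈ ⨆ i, 𝒜 i := by rw [hd.iSup_eq_top]; trivial
  change hd.proj i (b * a) ∈ (Submodule.span A {a} : Submodule A A)
  refine Submodule.iSup_induction 𝒜
    (motive := fun b => hd.proj i (b * a) ∈ (Submodule.span A {a} : Submodule A A)) hb ?_ ?_ ?_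
  · intro l c hc
    have hca := SetLike.mul_mem_graded hc ha
    by_cases h : i = l + j
    · subst h
      rw [hd.proj_of_mem hca]
      exact Submodule.mem_span_singleton.2 ⟨c, rfl⟩
    · rw [hd.proj_of_mem_ne h hca]
      exact Submodule.zero_mem _
  · simp
  · intro x y hx hy
    rw [add_mul, map_add]
    exact Submodule.add_mem _ hx hy

/-- The cyclic graded module `A / (a)` for a homogeneous element `a`. -/
def GrMod.quotSpan {j : ι} {a : A} (ha : a ∈ 𝒜 j) : GrMod 𝒜 :=
  (GrMod.self 𝒜).quotient (Submodule.span A {a} : Submodule A A) (span_singleton_proj (A := A) (𝒜 := 𝒜) ha)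

theorem quotSpan_shift_isFinPres [IsNoetherianRing A] {j : ι} {a : A} (ha : a ∈ 𝒜 j) (g : ι) :
    isFinPres 𝒜 ((GrMod.quotSpan ha).shift g) :=
  (Module.finitePresentation_iff_finite _ _).2
    (inferInstanceAs (Module.Finite A (A ⧸ (Submodule.span A {a} : Submodule A A))))

namespace GrMod

/-- The restriction `M_H = ⨁_{h ∈ H} M_h`, as a submodule over the restriction subalgebra. -/
def restrSubmodule (M : GrMod 𝒜) : Submodule (restrAlg 𝒜 H) M.carrier where
  carrier := partIn H M.deg
  add_mem' ha hb := Submodule.add_mem _ ha hb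
  zero_mem' := Submodule.zero_mem _
  smul_mem' a m hm := by
    have h := projIn_smul H M a.1 m hm
    rw [IsDirectSum.projIn_of_mem_partIn H IsGradedAlgebra.isDirectSum a.2] at h
    change a.1 • m ∈ partIn H M.deg
    rw [← h]
    exact M.isDirectSum.projIn_mem H _

/-- The restriction `M_H` as an `H`-graded module. -/
def restrObj (M : GrMod 𝒜) : GrMod (restrGrading 𝒜 H) where
  carrier := M.restrSubmodule H
  isScalarTower := inferInstance
  deg h := (M.deg h).comap ((M.restrSubmodule H).subtype.restrictScalars k)
  isDirectSum := M.isDirectSum.partIn_isDirectSum H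
  smul_mem ha hm := M.smul_mem ha hm

/-- The restriction of a morphism. -/
def restrMap {M N : GrMod 𝒜} (f : M ⟶ N) : M.restrObj H ⟶ N.restrObj H :=
  mkHom (((lin f).restrictScalars (restrAlg 𝒜 H)).restrict (p := M.restrSubmodule H)
    (q := N.restrSubmodule H) fun m hm => by
      have hle : partIn H M.deg ≤ (partIn H N.deg).comap ((lin f).restrictScalars k) :=
        iSup_le fun i x hx => Submodule.mem_iSup_of_mem i (lin_mem f hx)
      exact hle hm) fun _ _ hm => lin_mem f hm

end GrMod

variable (𝒜)

/-- The restriction functor on graded modules. -/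
def restrFunctor : GrMod 𝒜 ⥤ GrMod (restrGrading 𝒜 H) where
  obj M := M.restrObj H
  map f := GrMod.restrMap H f

theorem restrObj_isFinPres [IsNoetherianRing A] (M : GrMod 𝒜) (hM : isFinPres 𝒜 M) :
    isFinPres (restrGrading 𝒜 H) (M.restrObj H) := by
  have : Module.FinitePresentation A M.carrier := hM
  let P : M.carrier →+ M.restrSubmodule H :=
    ((M.isDirectSum.projIn H).codRestrict (partIn H M.deg)
      (M.isDirectSum.projIn_mem H)).toAddMonoidHom
  have hd := IsGradedAlgebra.isDirectSum (𝒜 := 𝒜)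
  have : IsNoetherian (restrAlg 𝒜 H) (M.restrSubmodule H) := by
    refine isNoetherian_of_retract (A := A) (M.restrSubmodule H).subtype P
      ((hd.projIn H).codRestrict (partIn H 𝒜) (hd.projIn_mem H)) ?_ ?_
    · intro n
      exact Subtype.ext (M.isDirectSum.projIn_of_mem_partIn H n.2)
    · intro a n
      exact Subtype.ext (projIn_smul H M a n.1 n.2)
  exact (Module.finitePresentation_iff_finite _ _).2
    (inferInstance : Module.Finite (restrAlg 𝒜 H) (M.restrSubmodule H))

variable [IsNoetherianRing A]

/-- The restriction functor on finitely presented graded modules. -/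
def restrFP : GrModFP 𝒜 ⥤ GrModFP (restrGrading 𝒜 H) :=
  ObjectProperty.lift _ ((isFinPres 𝒜).ι ⋙ restrFunctor 𝒜 H)
    fun M => restrObj_isFinPres 𝒜 H M.obj M.property

theorem restrFP_inverts : (finDimFP 𝒜).isoModSerre.IsInvertedBy
    (restrFP 𝒜 H ⋙ qFunctor (restrGrading 𝒜 H)) := by
  intro M N f hf
  apply MorphismProperty.Q_inverts
  rw [isoModSerre_finDimFP_iff] at hf ⊢
  obtain ⟨hk, hc⟩ := hf
  let F := GrMod.lin f.hom
  let F' := GrMod.lin (GrMod.restrMap H f.hom)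
  constructor
  · have : Module.Finite k (LinearMap.ker F) := hk
    change Module.Finite k (LinearMap.ker F')
    let g : LinearMap.ker F' →ₗ[k] LinearMap.ker F :=
      { toFun := fun x => ⟨x.1.1, congrArg Subtype.val x.2⟩
        map_add' := fun _ _ => rfl
        map_smul' := fun _ _ => rfl }
    exact Module.Finite.of_injective g fun x y hxy =>
      Subtype.ext (Subtype.ext (congrArg (fun z : LinearMap.ker F => z.1) hxy))
  · have : Module.Finite k (N.obj.carrier ⧸ LinearMap.range F) := hc
    change Module.Finite k (N.obj.restrSubmodule H ⧸ LinearMap.range F')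
    let g : N.obj.restrSubmodule H →ₗ[restrAlg 𝒜 H] N.obj.carrier ⧸ LinearMap.range F :=
      ((LinearMap.range F).mkQ.restrictScalars (restrAlg 𝒜 H)) ∘ₗ (N.obj.restrSubmodule H).subtype
    have hg : LinearMap.ker g = LinearMap.range F' := by
      apply le_antisymm
      · intro y hy
        obtain ⟨x, hx⟩ := (Submodule.Quotient.mk_eq_zero (LinearMap.range F)).1 hy
        refine ⟨⟨M.obj.isDirectSum.projIn H x, M.obj.isDirectSum.projIn_mem H x⟩, ?_⟩
        apply Subtype.ext
        change F (M.obj.isDirectSum.projIn H x) = y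
        refine (M.obj.isDirectSum.map_projIn H N.obj.isDirectSum (F.restrictScalars k)
          (fun _ _ hm => GrMod.lin_mem f.hom hm) x).symm.trans ?_
        change N.obj.isDirectSum.projIn H (F x) = y
        rw [hx]
        exact N.obj.isDirectSum.projIn_of_mem_partIn H y.2
      · rintro _ ⟨x, rfl⟩
        exact (Submodule.Quotient.mk_eq_zero (LinearMap.range F)).2 ⟨x.1, rfl⟩
    have hinj : Function.Injective ((LinearMap.range F').liftQ g hg.ge) := by
      rw [← LinearMap.ker_eq_bot]
      exact Submodule.ker_liftQ_eq_bot _ _ _ hg.le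
    exact Module.Finite.of_injective (((LinearMap.range F').liftQ g hg.ge).restrictScalars k) hinj

/-- The restriction functor between the quotient categories induced by the restriction functor,
characterized by `qFunctor ⋙ restrQ = restrFP ⋙ qFunctor`. -/
def restrQ : QMod 𝒜 ⥤ QMod (restrGrading 𝒜 H) :=
  Localization.Construction.lift (restrFP 𝒜 H ⋙ qFunctor (restrGrading 𝒜 H))
    (restrFP_inverts 𝒜 H)

end Restriction

end GradedModules

/-! ## Serre subcategories generated by a family of objects -/

section SerreClosure

variable {C : Type*} [Category* C] [Abelian C]

/-- The Serre subcategory generated by a class of objects: the smallest Serre subcategory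
containing it. -/
def serreClosure (P : ObjectProperty C) : ObjectProperty C :=
  fun X => ∀ Q : ObjectProperty C, Q.IsSerreClass → P ≤ Q → Q X

instance (P : ObjectProperty C) : (serreClosure P).IsSerreClass where
  exists_zero := by
    obtain ⟨Z, hZ⟩ := HasZeroObject.zero (C := C)
    exact ⟨Z, hZ, fun Q _ _ => Q.prop_of_isZero hZ⟩
  prop_of_mono f _ hY Q hQ hP := Q.prop_of_mono f (hY Q hQ hP)
  prop_of_epi f _ hX Q hQ hP := Q.prop_of_epi f (hX Q hQ hP)
  prop_X₂_of_shortExact hS h₁ h₃ Q hQ hP := Q.prop_X₂_of_shortExact hS (h₁ Q hQ hP) (h₃ Q hQ hP)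

end SerreClosure

/-! ## Weighted projective lines -/

/-- The data of a weighted projective line over `k`: a sequence of `t ≥ 2` weights `p i ≥ 1` and a
normalized sequence of pairwise distinct `k`-rational points `pt i` of the projective line
`k ∪ {∞}` (so the first three points are `∞`, `0` and `1`). The indices start at `0`. -/
structure WeightedLine (k : Type u) [Field k] where
  /-- the number of weights -/
  t : ℕ
  two_le : 2 ≤ t
  /-- the weights -/
  p : Fin t → ℕ
  one_le_p : ∀ i, 1 ≤ p i
  /-- the parameters -/
  pt : Fin t → OnePoint k
  pt_injective : Function.Injective pt
  pt_first : pt ⟨0, by omega⟩ = OnePoint.infty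
  pt_second : pt ⟨1, by omega⟩ = ((0 : k) : OnePoint k)
  pt_third : ∀ h : 2 < t, pt ⟨2, h⟩ = ((1 : k) : OnePoint k)

namespace WeightedLine

variable {k : Type u} [Field k] (X : WeightedLine k)

/-- The relations `p_i e_i = p_j e_j` of the string group. -/
def stringRel : AddSubgroup (Fin X.t → ℤ) :=
  AddSubgroup.closure {v | ∃ i j, v = Pi.single i (X.p i : ℤ) - Pi.single j (X.p j : ℤ)}

/-- The string group: the abelian group with generators `x_1, …, x_t` and relations
`p_1 x_1 = ⋯ = p_t x_t`. -/
abbrev StringGroup : Type := (Fin X.t → ℤ) ⧸ X.stringRel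

/-- The generators `x_i` of the string group. -/
def xvec (i : Fin X.t) : X.StringGroup := QuotientAddGroup.mk (Pi.single i 1)

/-- The homomorphism `π_i` from the string group to `ℤ / p_i` with `π_i (x_j) = δ_{ij}`. -/
def piHom (i : Fin X.t) : X.StringGroup →+ ZMod (X.p i) :=
  QuotientAddGroup.lift X.stringRel
    ((Int.castAddHom (ZMod (X.p i))).comp (Pi.evalAddMonoidHom (fun _ => ℤ) i)) (by
      rw [stringRel, AddSubgroup.closure_le]
      have key : ∀ j, ((Pi.single j (X.p j : ℤ) : Fin X.t → ℤ) i : ZMod (X.p i)) = 0 := by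
        intro j
        by_cases h : i = j
        · subst h
          simp
        · simp [Pi.single_eq_of_ne h]
      rintro _ ⟨j, l, rfl⟩
      simp [key])

theorem piHom_xvec (i j : Fin X.t) : X.piHom i (X.xvec j) = if i = j then 1 else 0 := by
  change (((Pi.single j 1 : Fin X.t → ℤ) i : ℤ) : ZMod (X.p i)) = _
  rw [Pi.single_apply]
  split_ifs <;> simp

/-- A subgroup `H` of the string group is effective if `π_i(H) = ℤ / p_i` for all `i`. -/
def IsEffective (H : AddSubgroup X.StringGroup) : Prop :=
  ∀ i, H.map (X.piHom i) = ⊤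

/-- The ideal of the defining relations `X_i ^ p_i = X_2 ^ p_2 - λ_i X_1 ^ p_1`, `3 ≤ i ≤ t`, of
the homogeneous coordinate algebra. (The variables `X_1`, `X_2` have index `0`, `1` here.) -/
def coordIdeal : Ideal (MvPolynomial (Fin X.t) k) :=
  Ideal.span {f | ∃ (i : Fin X.t) (a : k), 2 ≤ i.val ∧ X.pt i = (a : OnePoint k) ∧
    f = MvPolynomial.X i ^ X.p i -
      (MvPolynomial.X ⟨1, by have := X.two_le; omega⟩ ^ X.p ⟨1, by have := X.two_le; omega⟩ -
        MvPolynomial.C a *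
          MvPolynomial.X ⟨0, by have := X.two_le; omega⟩ ^ X.p ⟨0, by have := X.two_le; omega⟩)}

/-- The homogeneous coordinate algebra. -/
abbrev CoordAlg : Type u := MvPolynomial (Fin X.t) k ⧸ X.coordIdeal

/-- The generators `x_i` of the homogeneous coordinate algebra. -/
def x (i : Fin X.t) : X.CoordAlg := Ideal.Quotient.mk X.coordIdeal (MvPolynomial.X i)

/-- The grading of the homogeneous coordinate algebra by the string group, with `deg x_i = x_i`:
the component of degree `g` consists of the classes of the weighted homogeneous polynomials
of degree `g`. -/
def grading (g : X.StringGroup) : Submodule k X.CoordAlg :=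
  (MvPolynomial.weightedHomogeneousSubmodule k X.xvec g).map
    (Ideal.Quotient.mkₐ k X.coordIdeal).toLinearMap

theorem nsmul_xvec (i j : Fin X.t) : X.p i • X.xvec i = X.p j • X.xvec j := by
  have hs : ∀ l, X.p l • X.xvec l = QuotientAddGroup.mk (Pi.single l (X.p l : ℤ)) := by
    intro l
    rw [xvec, ← QuotientAddGroup.mk_nsmul, ← Pi.single_smul]
    simp
  rw [hs, hs, QuotientAddGroup.eq, neg_add_eq_sub]
  exact AddSubgroup.subset_closure ⟨j, i, rfl⟩

theorem coordIdeal_isHomogeneous (g : X.StringGroup) (f : MvPolynomial (Fin X.t) k)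
    (hf : f ∈ X.coordIdeal) :
    MvPolynomial.weightedHomogeneousComponent X.xvec g f ∈ X.coordIdeal := by
  classical
  let _ := MvPolynomial.weightedGradedAlgebra k X.xvec
  refine MvPolynomial.weightedHomogeneousComponent_mem_of_mem k X.xvec ?_ hf g
  refine Ideal.homogeneous_span _ _ ?_
  rintro _ ⟨i, a, -, -, rfl⟩
  let c := X.p i • X.xvec i
  have hX : ∀ j, (MvPolynomial.X j ^ X.p j : MvPolynomial (Fin X.t) k) ∈
      MvPolynomial.weightedHomogeneousSubmodule k X.xvec c := by
    intro j
    have h := (MvPolynomial.isWeightedHomogeneous_X k X.xvec j).pow (X.p j)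
    rw [X.nsmul_xvec j i] at h
    exact h
  refine ⟨c, Submodule.sub_mem _ (hX i) (Submodule.sub_mem _ (hX _) ?_)⟩
  rw [← MvPolynomial.smul_eq_C_mul]
  exact Submodule.smul_mem _ _ (hX _)

instance : IsGradedAlgebra X.grading where
  one_mem := ⟨1, MvPolynomial.isWeightedHomogeneous_one k X.xvec, map_one (Ideal.Quotient.mkₐ k X.coordIdeal)⟩
  mul_mem := by
    rintro i j _ _ ⟨a, ha, rfl⟩ ⟨b, hb, rfl⟩
    exact ⟨a * b, MvPolynomial.IsWeightedHomogeneous.mul ha hb, map_mul (Ideal.Quotient.mkₐ k X.coordIdeal) a b⟩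
  isDirectSum := by
    classical
    let _ := MvPolynomial.weightedGradedAlgebra k X.xvec
    have hd : IsDirectSum (MvPolynomial.weightedHomogeneousSubmodule k X.xvec) := by
      have h := DirectSum.Decomposition.isInternal
        (MvPolynomial.weightedHomogeneousSubmodule k X.xvec)
      unfold IsDirectSum
      convert h
      rfl
    have hproj : ∀ g f, hd.proj g f = MvPolynomial.weightedHomogeneousComponent X.xvec g f := by
      intro g f
      have hf : f ∈ ⨆ i, MvPolynomial.weightedHomogeneousSubmodule k X.xvec i := by
        rw [hd.iSup_eq_top]; trivial
      refine Submodule.iSup_induction _ (motive := fun f => hd.proj g f =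
        MvPolynomial.weightedHomogeneousComponent X.xvec g f) hf ?_ ?_ ?_
      · intro j f hf
        by_cases h : g = j
        · subst h
          rw [hd.proj_of_mem hf,
            MvPolynomial.IsWeightedHomogeneous.weightedHomogeneousComponent_same hf]
        · rw [hd.proj_of_mem_ne h hf,
            MvPolynomial.IsWeightedHomogeneous.weightedHomogeneousComponent_ne g hf h]
      · simp
      · intro x y hx hy
        rw [map_add, map_add, hx, hy]
    refine hd.map_of_surjective _ (Ideal.Quotient.mkₐ_surjective k X.coordIdeal) ?_
    intro g f hf
    rw [hproj]
    exact Ideal.Quotient.eq_zero_iff_mem.2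
      (X.coordIdeal_isHomogeneous g f (Ideal.Quotient.eq_zero_iff_mem.1 hf))

theorem x_mem (i : Fin X.t) : X.x i ∈ X.grading (X.xvec i) :=
  ⟨MvPolynomial.X i, MvPolynomial.isWeightedHomogeneous_X k X.xvec i, rfl⟩

/-- The object `S_i(l x_i)` of the quotient category: the image under the quotient functor
of the shifted graded module `(S / (x_i))(l x_i)`. (The shift of the quotient category is induced
by the shift of graded modules, so it commutes with the quotient functor.) -/
def simpleSheaf (i : Fin X.t) (l : ℕ) : QMod X.grading :=
  (qFunctor X.grading).obj
    ⟨(GrMod.quotSpan (X.x_mem i)).shift (l • X.xvec i), quotSpan_shift_isFinPres _ _⟩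

/-- The Serre subcategory `N_H` generated by the objects `S_i(l x_i)`, where `0 ≤ l ≤ p_i - 1` and
the class of `-l` does not belong to `π_i(H)`. -/
def kernelSerre (H : AddSubgroup X.StringGroup) : ObjectProperty (QMod X.grading) :=
  serreClosure fun Y => ∃ (i : Fin X.t) (l : ℕ), l ≤ X.p i - 1 ∧
    -(l : ZMod (X.p i)) ∉ H.map (X.piHom i) ∧ Y = X.simpleSheaf i l

instance (H : AddSubgroup X.StringGroup) : (X.kernelSerre H).IsSerreClass :=
  inferInstanceAs (serreClosure _).IsSerreClass

end WeightedLine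
end

/-!
Write `C` for the category of finitely presented `L`-graded `S`-modules and `D` for that of finitely
presented `H`-graded `S_H`-modules.

The restriction functor `C ⥤ D` is exact. It is moreover a localization, for which no adjoint is
needed: a morphism `f : M_H ⟶ N_H` is the fraction given by the two projections of the `S`-submodule
of `M × N` generated by the graph of `f`, the restriction of which is the graph itself
(`restrFP_roofs`). Every object of `D` is a quotient of a restriction (`restrFP_exists_epi`), hence
a cokernel of a morphism between restrictions, hence itself a restriction. An exact functor with these
properties is the quotient by its kernel (`isLocalization_kernel_of_exact_of_roofs`). Composition
with the quotient functor of `D` then shows that `restrQ` is the localization at the morphisms that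
it inverts (`restrQ_isLocalization`). All this holds for every graded Noetherian algebra.

So the first claim amounts to the equality of `N_H` with the kernel of `restrQ`
(`kernelSerre_eq_kernel`). The restrictions of the generators of `N_H` vanish, as an element of `S`
whose degree has nonzero image under `π_i` is divisible by `x_i`. Conversely, let `M_H` be finite
dimensional. As `H` is infinite, it contains the degree of a power of each `x_i`, so `S` is finite
over `S_H` and the submodule generated by `M_H` is finite dimensional. By Noetherian induction
(`GrModFP.prop_of_restr_finDim`) it remains to map an object of `N_H` nontrivially to each nonzero
module with zero restriction. In such a module every homogeneous element is killed by a monomial;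
this yields nonzero elements killed by some `x_i`, whose degrees either are excluded by `π_i(H)`, or
which have nonzero multiples killed by two variables (`exists_hom_of_restr_eq_zero`). As the `λ_i`
are distinct, a finite module killed by two variables is finite dimensional
(`finite_of_smul_eq_zero`). For the same reason `(S / (x_i))(y)` depends in the quotient category on
`π_i(y)` only, so that the generators of `N_H` suffice.

The second claim follows. For effective `H` the generating family of `N_H` is empty. Otherwise `N_H`
contains some `S_i(l x_i)`, which is nonzero as `S / (x_i)` is infinite dimensional
(`not_finite_quotSpan`).
-/

/-! ### Exact functors that are localizations -/

section Categories

variable {C C' D E : Type*} [Category* C] [Category* C'] [Category* D] [Category* E]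

/-- An exact, essentially surjective functor of abelian categories, for which every morphism
`F X ⟶ F Y` is a fraction `F g ∘ (F s)⁻¹`, is the quotient by its kernel. -/
theorem isLocalization_kernel_of_exact_of_roofs [Abelian C] [Abelian D] (F : C ⥤ D)
    [PreservesFiniteLimits F] [PreservesFiniteColimits F] [F.EssSurj]
    (hF : ∀ {X Y : C} (f : F.obj X ⟶ F.obj Y), ∃ (Z : C) (s : Z ⟶ X) (g : Z ⟶ Y),
      IsIso (F.map s) ∧ F.map s ≫ f = F.map g) :
    F.IsLocalization F.kernel.isoModSerre := by
  have hW : F.kernel.isoModSerre.IsInvertedBy F := by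
    rw [ObjectProperty.isoModSerre_isInvertedBy_iff]
  let Q := F.kernel.isoModSerre.Q
  let G := Localization.Construction.lift F hW
  have hQG : Q ⋙ G = F := Localization.Construction.fac F hW
  let e : Q ⋙ G ≅ F := eqToIso hQG
  have : F.Additive := Functor.additive_of_preserves_binary_products F
  have : (Q ⋙ G).Additive := Functor.additive_of_iso e.symm
  have : G.Additive := (Localization.functor_additive_iff Q F.kernel.isoModSerre G).2 this
  have hQ : Q.EssSurj := Localization.essSurj Q F.kernel.isoModSerre
  have key {X Y : C} (f : X ⟶ Y) : IsIso (F.map f) → IsIso (Q.map f) := fun h => by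
    apply Localization.inverts Q F.kernel.isoModSerre
    rw [Abelian.isoModSerre_kernel_eq_inverseImage_isomorphisms]
    exact h
  have : G.Faithful := by
    refine ⟨fun {A B} a b hab => ?_⟩
    rw [← sub_eq_zero]
    have h0 : G.map (a - b) = 0 := by rw [G.map_sub, hab, sub_self]
    generalize a - b = c at h0
    let eA := Q.objObjPreimageIso A
    let eB := Q.objObjPreimageIso B
    obtain ⟨φ, hφ⟩ := Localization.exists_rightFraction Q F.kernel.isoModSerre
      (eA.hom ≫ c ≫ eB.inv)
    have h1 : Q.map φ.s ≫ (eA.hom ≫ c ≫ eB.inv) = Q.map φ.f := by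
      rw [hφ, MorphismProperty.RightFraction.map_s_comp_map]
    have h2 : F.map φ.f = 0 := by
      have h3 : (Q ⋙ G).map φ.f = 0 := by
        change G.map (Q.map φ.f) = 0
        rw [← h1]
        simp [h0]
      have := e.hom.naturality φ.f
      rw [h3, zero_comp] at this
      exact (cancel_epi (e.hom.app _)).1 (by rw [← this, comp_zero])
    have h4 : Q.map φ.f = 0 := by
      rw [ObjectProperty.SerreClassLocalization.map_eq_zero_iff Q F.kernel]
      have hm : F.map (Abelian.image.ι φ.f) = 0 := by
        have := F.map_comp (Abelian.factorThruImage φ.f) (Abelian.image.ι φ.f)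
        rw [Abelian.image.fac, h2] at this
        exact (cancel_epi (F.map (Abelian.factorThruImage φ.f))).1 (by rw [← this, comp_zero])
      exact IsZero.of_mono_eq_zero _ hm
    have := Localization.inverts Q F.kernel.isoModSerre φ.s φ.hs
    rw [h4] at h1
    have h5 : eA.hom ≫ c ≫ eB.inv = 0 := (cancel_epi (Q.map φ.s)).1 (by rw [h1, comp_zero])
    rw [← cancel_epi eA.hom, ← cancel_mono eB.inv]
    simpa using h5
  have : G.Full := by
    refine ⟨fun {A B} f => ?_⟩
    let eA := Q.objObjPreimageIso A
    let eB := Q.objObjPreimageIso B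
    let f' : F.obj (Q.objPreimage A) ⟶ F.obj (Q.objPreimage B) :=
      e.inv.app _ ≫ G.map eA.hom ≫ f ≫ G.map eB.inv ≫ e.hom.app _
    obtain ⟨Z, s, g, hs, hsg⟩ := hF f'
    have := key s hs
    refine ⟨eA.inv ≫ inv (Q.map s) ≫ Q.map g ≫ eB.hom, ?_⟩
    have hs' : G.map (Q.map s) = e.hom.app _ ≫ F.map s ≫ e.inv.app _ := by
      rw [← e.hom.naturality_assoc, e.hom_inv_id_app, Category.comp_id]; rfl
    have hg' : G.map (Q.map g) = e.hom.app _ ≫ F.map g ≫ e.inv.app _ := by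
      rw [← e.hom.naturality_assoc, e.hom_inv_id_app, Category.comp_id]; rfl
    have h1 : G.map (Q.map g) = G.map (Q.map s) ≫ G.map eA.hom ≫ f ≫ G.map eB.inv := by
      rw [hg', hs', ← hsg]
      simp [f']
    simp only [G.map_comp, h1, Category.assoc, Functor.map_inv, IsIso.inv_hom_id_assoc]
    simp [← G.map_comp]
  have : G.EssSurj := by
    refine ⟨fun Y => ⟨Q.obj (F.objPreimage Y), ⟨e.app _ ≪≫ F.objObjPreimageIso Y⟩⟩⟩
  exact ⟨hW, { }⟩

/-- Under an exact functor for which every morphism `F X ⟶ F Y` is a fraction, the essential image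
is closed under cokernels; so it is everything as soon as every object is a quotient of some
`F X`. -/
theorem essSurj_of_exact_of_roofs [Abelian C] [Abelian D] (F : C ⥤ D)
    [PreservesFiniteLimits F] [PreservesFiniteColimits F]
    (hF : ∀ {X Y : C} (f : F.obj X ⟶ F.obj Y), ∃ (Z : C) (s : Z ⟶ X) (g : Z ⟶ Y),
      IsIso (F.map s) ∧ F.map s ≫ f = F.map g)
    (hq : ∀ Y : D, ∃ (X : C) (p : F.obj X ⟶ Y), Epi p) : F.EssSurj := by
  refine ⟨fun Y => ?_⟩
  have : F.Additive := Functor.additive_of_preserves_binary_products F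
  obtain ⟨X₀, p, hp⟩ := hq Y
  obtain ⟨X₁, q, hq⟩ := hq (kernel p)
  obtain ⟨Z, s, g, hs, hsg⟩ := hF (q ≫ kernel.ι p)
  have hz : F.map g ≫ p = 0 := by simp [← hsg]
  have hex : (ShortComplex.mk (F.map g) p hz).Exact := by
    let φ : ShortComplex.mk (F.map g) p hz ⟶
        ShortComplex.mk (kernel.ι p) p (kernel.condition p) :=
      { τ₁ := F.map s ≫ q, τ₂ := 𝟙 _, τ₃ := 𝟙 _, comm₁₂ := by simp [← hsg] }
    have : Epi φ.τ₁ := inferInstanceAs (Epi (F.map s ≫ q))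
    have : IsIso φ.τ₂ := inferInstanceAs (IsIso (𝟙 _))
    have : Mono φ.τ₃ := inferInstanceAs (Mono (𝟙 _))
    rw [ShortComplex.exact_iff_of_epi_of_isIso_of_mono φ]
    exact ShortComplex.exact_of_f_is_kernel _ (kernelIsKernel p)
  have : Epi (ShortComplex.mk (F.map g) p hz).g := hp
  exact ⟨cokernel g, ⟨PreservesCokernel.iso F g ≪≫
    (colimit.isColimit _).coconePointUniqueUpToIso hex.gIsCokernel⟩⟩

/-- If `L` is a localization and `L ⋙ G` is the localization at the morphisms that it inverts, then
so is `G`. -/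
theorem isLocalization_inverseImage_of_comp (L : C ⥤ C') (G : C' ⥤ E)
    (W : MorphismProperty C) [L.IsLocalization W] [W.HasLeftCalculusOfFractions]
    [(L ⋙ G).IsLocalization ((MorphismProperty.isomorphisms E).inverseImage (L ⋙ G))] :
    G.IsLocalization ((MorphismProperty.isomorphisms E).inverseImage G) := by
  refine Functor.IsLocalization.of_comp L G W _
    ((MorphismProperty.isomorphisms E).inverseImage (L ⋙ G)) ?_ ?_
  · intro X Y f hf
    have := Localization.inverts L W f hf
    exact inferInstanceAs (IsIso (G.map (L.map f)))
  · apply le_antisymm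
    · intro X Y f hf
      have := Localization.essSurj_mapArrow L W
      have e := L.mapArrow.objObjPreimageIso (Arrow.mk f)
      refine ((MorphismProperty.map _ L).arrow_mk_iso_iff e).1
        (MorphismProperty.map_mem_map _ _ _ ?_)
      exact ((MorphismProperty.inverseImage _ G).arrow_mk_iso_iff e).2 hf
    · rw [MorphismProperty.map_le_iff]
      intro X Y f hf
      exact hf

/-- The composite of two localizations is the localization at the morphisms that it inverts. The
calculus of fractions serves to lift morphisms of `C'` to morphisms of `C`. -/
theorem isLocalization_inverseImage_comp (L : C ⥤ C') (G : C' ⥤ E)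
    (W : MorphismProperty C) [L.IsLocalization W] [W.HasLeftCalculusOfFractions]
    (W' : MorphismProperty C') [G.IsLocalization W'] :
    (L ⋙ G).IsLocalization ((MorphismProperty.isomorphisms E).inverseImage (L ⋙ G)) := by
  refine Functor.IsLocalization.comp L G W W' _ (fun _ _ _ h => h) ?_ ?_
  · intro X Y f hf
    have := Localization.inverts L W f hf
    exact inferInstanceAs (IsIso (G.map (L.map f)))
  · intro X Y f hf
    have := Localization.essSurj_mapArrow L W
    have e := L.mapArrow.objObjPreimageIso (Arrow.mk f)
    refine ((MorphismProperty.map _ L).arrow_mk_iso_iff e).1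
        (MorphismProperty.map_mem_map _ _ _ ?_)
    have h1 : (MorphismProperty.isomorphisms E).inverseImage G f :=
      Localization.inverts G W' f hf
    exact ((MorphismProperty.inverseImage _ G).arrow_mk_iso_iff e).2 h1

end Categories

/-! ### Exactness for graded modules -/

section GradedExactness

variable {k A : Type u} [Field k] [CommRing A] [Algebra k A] {ι : Type v} [AddCommGroup ι]
  {𝒜 : ι → Submodule k A}

theorem GrMod.exact_iff (S : ShortComplex (GrMod 𝒜)) :
    S.Exact ↔ ∀ y, GrMod.lin S.g y = 0 → ∃ x, GrMod.lin S.f x = y := by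
  let e : kernel S.g ≅ GrMod.ker S.g :=
    (limit.isLimit _).conePointUniqueUpToIso (GrMod.kerIsLimit S.g)
  have he : e.hom ≫ GrMod.kerι S.g = kernel.ι S.g :=
    (limit.isLimit _).conePointUniqueUpToIso_hom_comp (GrMod.kerIsLimit S.g)
      WalkingParallelPair.zero
  let l : S.X₁ ⟶ GrMod.ker S.g := kernel.lift S.g S.f S.zero ≫ e.hom
  have hl : l ≫ GrMod.kerι S.g = S.f := by simp [l, he]
  have hepi : S.Exact ↔ Epi l := by
    rw [ShortComplex.exact_iff_epi_kernel_lift]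
    constructor
    · intro _
      exact epi_comp _ _
    · intro h
      have h1 : kernel.lift S.g S.f S.zero = l ≫ e.inv := by simp [l]
      rw [h1]
      exact epi_comp _ _
  rw [hepi, GrMod.epi_iff]
  have hl' : ∀ x, (lin l x).1 = GrMod.lin S.f x :=
    fun x => LinearMap.congr_fun (congrArg GrMod.lin hl) x
  constructor
  · intro h y hy
    obtain ⟨x, hx⟩ := h ⟨y, hy⟩
    exact ⟨x, by rw [← hl', hx]⟩
  · rintro h ⟨y, hy⟩
    obtain ⟨x, hx⟩ := h y hy
    exact ⟨x, Subtype.ext ((hl' x).trans hx)⟩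

namespace GrModFP

variable [IsNoetherianRing A]

theorem exact_iff (S : ShortComplex (GrModFP 𝒜)) :
    S.Exact ↔ ∀ y, GrMod.lin S.g.hom y = 0 → ∃ x, GrMod.lin S.f.hom x = y := by
  rw [← ShortComplex.exact_map_iff_of_faithful S (isFinPres 𝒜).ι]
  exact GrMod.exact_iff _

theorem epi_of_surjective {M N : GrModFP 𝒜} (f : M ⟶ N)
    (hf : Function.Surjective (GrMod.lin f.hom)) : Epi f :=
  (isFinPres 𝒜).ι.epi_of_epi_map ((GrMod.epi_iff f.hom).2 hf)

theorem isIso_of_bijective {M N : GrModFP 𝒜} (f : M ⟶ N)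
    (hf : Function.Bijective (GrMod.lin f.hom)) : IsIso f := by
  have : IsIso ((isFinPres 𝒜).ι.map f) := GrMod.isIso_of_bijective f.hom hf
  exact isIso_of_reflects_iso f (isFinPres 𝒜).ι

end GrModFP

end GradedExactness

/-! ### Homogeneous submodules -/

section Homogeneous

variable {k A : Type u} [Field k] [CommRing A] [Algebra k A] {ι : Type v} [AddCommGroup ι]
  {𝒜 : ι → Submodule k A}

theorem GrMod.induction_on (M : GrMod 𝒜) {p : M.carrier → Prop}
    (homogeneous : ∀ i, ∀ m ∈ M.deg i, p m) (zero : p 0) (add : ∀ x y, p x → p y → p (x + y))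
    (m : M.carrier) : p m := by
  have hm : m ∈ ⨆ i, M.deg i := by rw [M.isDirectSum.iSup_eq_top]; trivial
  exact Submodule.iSup_induction _ (motive := p) hm homogeneous zero add

variable (𝒜) in
theorem IsGradedAlgebra.induction_on [IsGradedAlgebra 𝒜] {p : A → Prop}
    (homogeneous : ∀ i, ∀ a ∈ 𝒜 i, p a) (zero : p 0) (add : ∀ x y, p x → p y → p (x + y))
    (a : A) : p a :=
  (GrMod.self 𝒜).induction_on homogeneous zero add a

theorem GrMod.restr_induction_on [IsGradedAlgebra 𝒜] (H : AddSubgroup ι) (M : GrMod 𝒜)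
    {p : M.restrSubmodule H → Prop}
    (homogeneous : ∀ (h : H) (m : M.restrSubmodule H), m.1 ∈ M.deg h → p m) (zero : p 0)
    (add : ∀ x y, p x → p y → p (x + y)) (m : M.restrSubmodule H) : p m :=
  (M.restrObj H).induction_on homogeneous zero add m

/-- A homogeneous scalar shifts the projections onto the components. -/
theorem GrMod.proj_smul_of_mem (M : GrMod 𝒜) {d : ι} {a : A} (ha : a ∈ 𝒜 d) (m : M.carrier)
    (i : ι) : M.proj i (a • m) = a • M.proj (i - d) m := by
  induction m using M.induction_on with
  | homogeneous j x hx =>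
    have hax := M.smul_mem ha hx
    by_cases h : i = d + j
    · subst h
      rw [add_sub_cancel_left, proj, proj, M.isDirectSum.proj_of_mem hax,
        M.isDirectSum.proj_of_mem hx]
    · rw [proj, proj, M.isDirectSum.proj_of_mem_ne h hax, M.isDirectSum.proj_of_mem_ne _ hx,
        smul_zero]
      rintro rfl
      exact h (by abel)
  | zero => simp
  | add x y hx hy => rw [smul_add, map_add, map_add, hx, hy, smul_add]

/-- A nonzero graded module has a nonzero homogeneous element. -/
theorem GrMod.exists_homogeneous_ne_zero (M : GrMod 𝒜) (hM : Nontrivial M.carrier) :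
    ∃ i, ∃ m ∈ M.deg i, m ≠ 0 := by
  by_contra! h
  obtain ⟨x, hx⟩ := exists_ne (0 : M.carrier)
  exact hx (M.induction_on (p := fun m => m = 0) h rfl (fun x y hx hy => by simp [hx, hy]) x)

/-- A submodule generated by homogeneous elements is homogeneous. -/
theorem GrMod.span_proj [IsGradedAlgebra 𝒜] (M : GrMod 𝒜) (s : Set M.carrier)
    (hs : ∀ m ∈ s, ∃ i, m ∈ M.deg i) :
    ∀ i, ∀ m ∈ Submodule.span A s, M.proj i m ∈ Submodule.span A s := by
  intro i m hm
  -- the induction needs all multiples of `m`, as the projections are not `A`-linear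
  suffices h : ∀ a : A, M.proj i (a • m) ∈ Submodule.span A s by simpa using h 1
  refine Submodule.span_induction (p := fun m _ => ∀ a : A, M.proj i (a • m) ∈ Submodule.span A s)
    ?_ ?_ ?_ ?_ hm
  · intro m hm a
    obtain ⟨j, hj⟩ := hs m hm
    induction a using IsGradedAlgebra.induction_on 𝒜 with
    | homogeneous d a ha =>
      rw [M.proj_smul_of_mem ha]
      by_cases h : i - d = j
      · subst h
        rw [proj, M.isDirectSum.proj_of_mem hj]
        exact Submodule.smul_mem _ _ (Submodule.subset_span hm)
      · rw [proj, M.isDirectSum.proj_of_mem_ne h hj, smul_zero]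
        exact Submodule.zero_mem _
    | zero => simp
    | add x y hx hy => rw [add_smul, map_add]; exact Submodule.add_mem _ hx hy
  · simp
  · intro x y _ _ hx hy a
    rw [smul_add, map_add]
    exact Submodule.add_mem _ (hx a) (hy a)
  · intro b x _ hx a
    rw [smul_smul]
    exact hx _

end Homogeneous

/-! ### The restriction functor is a localization -/

section Restriction

variable {k A : Type u} [Field k] [CommRing A] [Algebra k A] {ι : Type v} [AddCommGroup ι]
  (𝒜 : ι → Submodule k A) [IsGradedAlgebra 𝒜] (H : AddSubgroup ι) [IsNoetherianRing A]

instance : (restrFP 𝒜 H).Additive where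

theorem restrFP_map_exact (S : ShortComplex (GrModFP 𝒜)) (hS : S.Exact) :
    (S.map (restrFP 𝒜 H)).Exact := by
  rw [GrModFP.exact_iff] at hS ⊢
  intro y hy
  obtain ⟨x, hx⟩ := hS y.1 (congrArg Subtype.val hy)
  refine ⟨⟨S.X₁.obj.isDirectSum.projIn H x, S.X₁.obj.isDirectSum.projIn_mem H x⟩, ?_⟩
  apply Subtype.ext
  change GrMod.lin S.f.hom (S.X₁.obj.isDirectSum.projIn H x) = y.1
  refine (S.X₁.obj.isDirectSum.map_projIn H S.X₂.obj.isDirectSum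
    ((GrMod.lin S.f.hom).restrictScalars k) (fun _ _ hm => GrMod.lin_mem S.f.hom hm)
    x).symm.trans ?_
  change S.X₂.obj.isDirectSum.projIn H (GrMod.lin S.f.hom x) = _
  rw [hx]
  exact S.X₂.obj.isDirectSum.projIn_of_mem_partIn H y.2

instance : PreservesFiniteLimits (restrFP 𝒜 H) :=
  (((restrFP 𝒜 H).exact_tfae.out 1 3 :).1 (restrFP_map_exact 𝒜 H)).1

instance : PreservesFiniteColimits (restrFP 𝒜 H) :=
  (((restrFP 𝒜 H).exact_tfae.out 1 3 :).1 (restrFP_map_exact 𝒜 H)).2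

/-- Every morphism `f : M_H ⟶ N_H` is a fraction of restrictions: the submodule of `M × N`
generated by the graph of `f` has the graph of `f` as its restriction. -/
theorem restrFP_roofs {M N : GrModFP 𝒜} (f : (restrFP 𝒜 H).obj M ⟶ (restrFP 𝒜 H).obj N) :
    ∃ (Z : GrModFP 𝒜) (s : Z ⟶ M) (g : Z ⟶ N),
      IsIso ((restrFP 𝒜 H).map s) ∧ (restrFP 𝒜 H).map s ≫ f = (restrFP 𝒜 H).map g := by
  let P := GrMod.prod M.obj N.obj
  let F : M.obj.restrSubmodule H →ₗ[restrAlg 𝒜 H] N.obj.restrSubmodule H := GrMod.lin f.hom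
  have hF : ∀ (h : H) (m : M.obj.restrSubmodule H), m.1 ∈ M.obj.deg h → (F m).1 ∈ N.obj.deg h :=
    fun h m hm => GrMod.lin_mem f.hom (i := h) hm
  let graph : Set P.carrier :=
    {z | ∃ m : M.obj.restrSubmodule H, (∃ h : H, m.1 ∈ M.obj.deg h) ∧ z = (m.1, (F m).1)}
  let U := Submodule.span A graph
  have hU : ∀ i, ∀ z ∈ U, P.proj i z ∈ U := by
    apply GrMod.span_proj
    rintro _ ⟨m, ⟨h, hm⟩, rfl⟩
    exact ⟨h, hm, hF h m hm⟩
  have hUH : ∀ z ∈ U, z ∈ partIn H P.deg → ∃ m : M.obj.restrSubmodule H, z = (m.1, (F m).1) := by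
    intro z hz hzH
    rw [← P.isDirectSum.projIn_of_mem_partIn H hzH]
    suffices h : ∀ a : A, ∃ m : M.obj.restrSubmodule H,
        P.isDirectSum.projIn H (a • z) = (m.1, (F m).1) by simpa using h 1
    refine Submodule.span_induction (p := fun z _ => ∀ a : A, ∃ m : M.obj.restrSubmodule H,
        P.isDirectSum.projIn H (a • z) = (m.1, (F m).1)) ?_ ?_ ?_ ?_ hz
    · rintro _ ⟨m, ⟨h, hm⟩, rfl⟩ a
      have hz : ((m.1, (F m).1) : P.carrier) ∈ partIn H P.deg :=
        Submodule.mem_iSup_of_mem (p := fun h : H => P.deg h) h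
          (show (m.1, (F m).1) ∈ P.deg h from ⟨hm, hF h m hm⟩)
      let b : restrAlg 𝒜 H := ⟨(IsGradedAlgebra.isDirectSum (𝒜 := 𝒜)).projIn H a,
        (IsGradedAlgebra.isDirectSum (𝒜 := 𝒜)).projIn_mem H a⟩
      refine ⟨b • m, ?_⟩
      rw [projIn_smul H P a _ hz, map_smul]
      rfl
    · intro a
      refine ⟨0, ?_⟩
      rw [smul_zero, map_zero, map_zero]
      rfl
    · intro x y _ _ hx hy a
      obtain ⟨m, hm⟩ := hx a
      obtain ⟨n, hn⟩ := hy a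
      refine ⟨m + n, ?_⟩
      rw [smul_add, map_add, hm, hn, map_add]
      rfl
    · intro b x _ hx a
      rw [smul_smul]
      exact hx _
  have hfin : isFinPres 𝒜 (P.sub U hU) := by
    have h1 : Module.FinitePresentation A M.obj.carrier := M.property
    have h2 : Module.FinitePresentation A N.obj.carrier := N.property
    have : IsNoetherian A P.carrier :=
      isNoetherian_prod (R := A) (M := M.obj.carrier) (N := N.obj.carrier)
    exact (Module.finitePresentation_iff_finite _ _).2 (inferInstanceAs (Module.Finite A U))
  let Z : GrModFP 𝒜 := ⟨P.sub U hU, hfin⟩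
  have hZ : ∀ z : Z.obj.restrSubmodule H, ∃ m : M.obj.restrSubmodule H,
      z.1.1 = (m.1, (F m).1) := by
    intro z
    refine hUH z.1.1 z.1.2 ?_
    have hle : partIn H Z.obj.deg ≤ (partIn H P.deg).comap (U.subtype.restrictScalars k) :=
      iSup_le fun i x hx => Submodule.mem_iSup_of_mem i hx
    exact hle z.2
  have hgraph : ∀ m : M.obj.restrSubmodule H, ∃ z : Z.obj.restrSubmodule H,
      z.1.1 = (m.1, (F m).1) := by
    intro m
    induction m using GrMod.restr_induction_on H M.obj with
    | homogeneous h m hm =>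
      exact ⟨⟨⟨_, Submodule.subset_span ⟨m, ⟨h, hm⟩, rfl⟩⟩,
        Submodule.mem_iSup_of_mem h ⟨hm, hF h m hm⟩⟩, rfl⟩
    | zero => exact ⟨0, by simp only [map_zero]; rfl⟩
    | add x y hx hy =>
      obtain ⟨z, hz⟩ := hx
      obtain ⟨w, hw⟩ := hy
      refine ⟨z + w, ?_⟩
      simp only [map_add]
      exact congrArg₂ (· + ·) hz hw
  let s : Z ⟶ M := ObjectProperty.homMk
    (GrMod.mkHom ((LinearMap.fst A M.obj.carrier N.obj.carrier) ∘ₗ U.subtype) fun _ _ hm => hm.1)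
  let g : Z ⟶ N := ObjectProperty.homMk
    (GrMod.mkHom ((LinearMap.snd A M.obj.carrier N.obj.carrier) ∘ₗ U.subtype) fun _ _ hm => hm.2)
  refine ⟨Z, s, g, ?_, ?_⟩
  · apply GrModFP.isIso_of_bijective
    constructor
    · rw [injective_iff_map_eq_zero]
      intro z hz
      obtain ⟨m, hm⟩ := hZ z
      have h1 : z.1.1.1 = 0 := congrArg Subtype.val hz
      rw [hm] at h1
      have h2 : m = 0 := Subtype.ext h1
      rw [h2, map_zero] at hm
      exact Subtype.ext (Subtype.ext hm)
    · intro m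
      obtain ⟨z, hz⟩ := hgraph m
      exact ⟨z, Subtype.ext (congrArg Prod.fst hz)⟩
  · apply ObjectProperty.hom_ext
    apply GrMod.hom_ext
    refine LinearMap.ext fun z => Subtype.ext ?_
    obtain ⟨m, hm⟩ := hZ z
    have h1 : GrMod.lin ((restrFP 𝒜 H).map s).hom z = m :=
      Subtype.ext (congrArg Prod.fst hm)
    change (F (GrMod.lin ((restrFP 𝒜 H).map s).hom z)).1 = z.1.1.2
    rw [h1, hm]

/-- Every finitely presented `A_H`-module is a quotient of a restriction, namely of that of a
finite direct sum of shifts of `A`. -/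
theorem restrFP_exists_epi (N : GrModFP (restrGrading 𝒜 H)) :
    ∃ (X : GrModFP 𝒜) (p : (restrFP 𝒜 H).obj X ⟶ N), Epi p := by
  have h0 : isFinPres 𝒜 (GrMod.zeroObj 𝒜) :=
    (Module.finitePresentation_iff_finite _ _).2 (inferInstanceAs (Module.Finite A PUnit.{u + 1}))
  have hsup : ∀ (X₁ X₂ : GrModFP 𝒜) (p₁ : (restrFP 𝒜 H).obj X₁ ⟶ N)
      (p₂ : (restrFP 𝒜 H).obj X₂ ⟶ N), ∃ (X : GrModFP 𝒜) (p : (restrFP 𝒜 H).obj X ⟶ N),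
        LinearMap.range (GrMod.lin p₁.hom) ≤ LinearMap.range (GrMod.lin p.hom) ∧
        LinearMap.range (GrMod.lin p₂.hom) ≤ LinearMap.range (GrMod.lin p.hom) := by
    intro X₁ X₂ p₁ p₂
    let p : (restrFP 𝒜 H).obj (X₁ ⊞ X₂) ⟶ N :=
      (restrFP 𝒜 H).map biprod.fst ≫ p₁ + (restrFP 𝒜 H).map biprod.snd ≫ p₂
    have h1 : (restrFP 𝒜 H).map biprod.inl ≫ p = p₁ := by
      simp [p, ← Functor.map_comp_assoc]
    have h2 : (restrFP 𝒜 H).map biprod.inr ≫ p = p₂ := by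
      simp [p, ← Functor.map_comp_assoc]
    refine ⟨_, p, ?_, ?_⟩
    · rintro _ ⟨x, rfl⟩
      rw [← h1]
      exact ⟨_, rfl⟩
    · rintro _ ⟨x, rfl⟩
      rw [← h2]
      exact ⟨_, rfl⟩
  have hmem : ∀ n : N.obj.carrier, ∃ (X : GrModFP 𝒜) (p : (restrFP 𝒜 H).obj X ⟶ N),
      n ∈ LinearMap.range (GrMod.lin p.hom) := by
    intro n
    induction n using N.obj.induction_on with
    | homogeneous h n hn =>
      have hfin : isFinPres 𝒜 ((GrMod.self 𝒜).shift (-(h : ι))) :=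
        inferInstanceAs (Module.FinitePresentation A A)
      let X : GrModFP 𝒜 := ⟨(GrMod.self 𝒜).shift (-(h : ι)), hfin⟩
      have hX : ∀ x : X.obj.restrSubmodule H, x.1 ∈ restrAlg 𝒜 H := by
        intro x
        have hle : partIn H X.obj.deg ≤ partIn H 𝒜 :=
          iSup_le fun g => le_iSup (fun h : H => 𝒜 h) (-h + g)
        exact hle x.2
      let F : X.obj.restrSubmodule H →ₗ[restrAlg 𝒜 H] N.obj.carrier :=
        { toFun := fun x => (⟨x.1, hX x⟩ : restrAlg 𝒜 H) • n
          map_add' := fun x y => add_smul (⟨x.1, hX x⟩ : restrAlg 𝒜 H) ⟨y.1, hX y⟩ n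
          map_smul' := fun a x => mul_smul a (⟨x.1, hX x⟩ : restrAlg 𝒜 H) n }
      let p : (restrFP 𝒜 H).obj X ⟶ N := ObjectProperty.homMk
        (GrMod.mkHom F fun g x hx => by
          have h1 := N.obj.smul_mem (i := -h + g) (a := ⟨x.1, hX x⟩) hx hn
          rwa [show -h + g + h = g by abel] at h1)
      have h1 : (1 : A) ∈ 𝒜 (-(h : ι) + h) := by
        rw [neg_add_cancel]; exact SetLike.one_mem_graded 𝒜
      exact ⟨X, p, ⟨(1 : A), Submodule.mem_iSup_of_mem h h1⟩, one_smul (restrAlg 𝒜 H) n⟩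
    | zero => exact ⟨⟨GrMod.zeroObj 𝒜, h0⟩, 0, Submodule.zero_mem _⟩
    | add x y hx hy =>
      obtain ⟨X₁, p₁, h₁⟩ := hx
      obtain ⟨X₂, p₂, h₂⟩ := hy
      obtain ⟨X, p, hp₁, hp₂⟩ := hsup X₁ X₂ p₁ p₂
      exact ⟨X, p, Submodule.add_mem _ (hp₁ h₁) (hp₂ h₂)⟩
  have : Module.FinitePresentation (restrAlg 𝒜 H) N.obj.carrier := N.property
  obtain ⟨s, hs⟩ := (inferInstance : Module.Finite (restrAlg 𝒜 H) N.obj.carrier).fg_top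
  have hs' : ∃ (X : GrModFP 𝒜) (p : (restrFP 𝒜 H).obj X ⟶ N),
      ∀ n ∈ s, n ∈ LinearMap.range (GrMod.lin p.hom) := by
    clear hs
    classical
    induction s using Finset.induction_on with
    | empty => exact ⟨⟨GrMod.zeroObj 𝒜, h0⟩, 0, by simp⟩
    | insert n s _ ih =>
      obtain ⟨X₁, p₁, h₁⟩ := hmem n
      obtain ⟨X₂, p₂, h₂⟩ := ih
      obtain ⟨X, p, hp₁, hp₂⟩ := hsup X₁ X₂ p₁ p₂
      refine ⟨X, p, fun m hm => ?_⟩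
      rcases Finset.mem_insert.1 hm with rfl | hm
      · exact hp₁ h₁
      · exact hp₂ (h₂ m hm)
  obtain ⟨X, p, hp⟩ := hs'
  refine ⟨X, p, GrModFP.epi_of_surjective p ?_⟩
  rw [← LinearMap.range_eq_top, eq_top_iff, ← hs]
  exact Submodule.span_le.2 hp

end Restriction

/-! ### The restriction functor between the quotient categories -/

section QuotientRestriction

variable {k A : Type u} [Field k] [CommRing A] [Algebra k A] {ι : Type v} [AddCommGroup ι]
  (𝒜 : ι → Submodule k A) [IsGradedAlgebra 𝒜] (H : AddSubgroup ι) [IsNoetherianRing A]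

instance : PreservesFiniteLimits (qFunctor 𝒜) :=
  ObjectProperty.SerreClassLocalization.preservesFiniteLimits (qFunctor 𝒜) (finDimFP 𝒜)

instance : PreservesFiniteColimits (qFunctor 𝒜) :=
  ObjectProperty.SerreClassLocalization.preservesFiniteColimits (qFunctor 𝒜) (finDimFP 𝒜)

theorem qFunctor_comp_restrQ :
    qFunctor 𝒜 ⋙ restrQ 𝒜 H = restrFP 𝒜 H ⋙ qFunctor (restrGrading 𝒜 H) :=
  Localization.Construction.fac _ _

instance : PreservesFiniteLimits (restrQ 𝒜 H) := by
  rw [← ObjectProperty.SerreClassLocalization.preservesFiniteLimits_comp_iff (qFunctor 𝒜)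
    (finDimFP 𝒜), qFunctor_comp_restrQ]
  infer_instance

instance : PreservesFiniteColimits (restrQ 𝒜 H) := by
  rw [← ObjectProperty.SerreClassLocalization.preservesFiniteColimits_comp_iff (qFunctor 𝒜)
    (finDimFP 𝒜), qFunctor_comp_restrQ]
  infer_instance

theorem restrQ_isLocalization :
    (restrQ 𝒜 H).IsLocalization
      ((MorphismProperty.isomorphisms _).inverseImage (restrQ 𝒜 H)) := by
  have hroofs {X Y : GrModFP 𝒜} (f : (restrFP 𝒜 H).obj X ⟶ (restrFP 𝒜 H).obj Y) :=
    restrFP_roofs 𝒜 H f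
  have : (restrFP 𝒜 H).EssSurj :=
    essSurj_of_exact_of_roofs _ hroofs (restrFP_exists_epi 𝒜 H)
  have : (restrFP 𝒜 H).IsLocalization (restrFP 𝒜 H).kernel.isoModSerre :=
    isLocalization_kernel_of_exact_of_roofs _ hroofs
  have h := isLocalization_inverseImage_comp (restrFP 𝒜 H) (qFunctor (restrGrading 𝒜 H))
    (restrFP 𝒜 H).kernel.isoModSerre (finDimFP (restrGrading 𝒜 H)).isoModSerre
  rw [← qFunctor_comp_restrQ] at h
  exact isLocalization_inverseImage_of_comp (qFunctor 𝒜) _ (finDimFP 𝒜).isoModSerre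

/-- The restriction functor is the quotient functor by every Serre subcategory that coincides with
its kernel. -/
theorem restrQ_isLocalization_of_eq_kernel (N : ObjectProperty (QMod 𝒜)) [N.IsSerreClass]
    (hN : N = (restrQ 𝒜 H).kernel) : (restrQ 𝒜 H).IsLocalization N.isoModSerre := by
  subst hN
  rw [Abelian.isoModSerre_kernel_eq_inverseImage_isomorphisms]
  exact restrQ_isLocalization 𝒜 H

theorem restrQ_kernel_qFunctor_iff (M : GrModFP 𝒜) :
    (restrQ 𝒜 H).kernel ((qFunctor 𝒜).obj M) ↔
      finDimFP (restrGrading 𝒜 H) ((restrFP 𝒜 H).obj M) := by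
  rw [← ObjectProperty.SerreClassLocalization.isZero_obj_iff (qFunctor (restrGrading 𝒜 H))
    (finDimFP (restrGrading 𝒜 H))]
  rfl

end QuotientRestriction

/-! ### Modules whose restriction is finite dimensional -/

section Devissage

variable {k A : Type u} [Field k] [CommRing A] [Algebra k A] {ι : Type v} [AddCommGroup ι]
  {𝒜 : ι → Submodule k A} [IsNoetherianRing A]

namespace GrModFP

/-- A homogeneous submodule of a finitely presented graded module. -/
abbrev sub (M : GrModFP 𝒜) (N : Submodule A M.obj.carrier)
    (hN : ∀ i, ∀ m ∈ N, M.obj.proj i m ∈ N) : GrModFP 𝒜 :=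
  ⟨M.obj.sub N hN, by
    have : Module.FinitePresentation A M.obj.carrier := M.property
    exact (Module.finitePresentation_iff_finite _ _).2 (inferInstanceAs (Module.Finite A N))⟩

/-- The quotient of a finitely presented graded module by a homogeneous submodule. -/
abbrev quotient (M : GrModFP 𝒜) (N : Submodule A M.obj.carrier)
    (hN : ∀ i, ∀ m ∈ N, M.obj.proj i m ∈ N) : GrModFP 𝒜 :=
  ⟨M.obj.quotient N hN, by
    have : Module.FinitePresentation A M.obj.carrier := M.property
    exact (Module.finitePresentation_iff_finite _ _).2
      (inferInstanceAs (Module.Finite A (M.obj.carrier ⧸ N)))⟩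

/-- Noetherian induction: a Serre class contains `M` if it contains a homogeneous submodule `N₀`
of `M` and if it has an object with a nonzero morphism to each proper quotient of `M ⧸ N₀`. -/
theorem prop_of_exists_hom_to_quotient (P : ObjectProperty (GrModFP 𝒜)) [P.IsSerreClass]
    (M : GrModFP 𝒜) (N₀ : Submodule A M.obj.carrier) (h₀ : ∀ i, ∀ m ∈ N₀, M.obj.proj i m ∈ N₀)
    (hP₀ : P (M.sub N₀ h₀))
    (hstep : ∀ (N : Submodule A M.obj.carrier) (hN : ∀ i, ∀ m ∈ N, M.obj.proj i m ∈ N),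
      N₀ ≤ N → N ≠ ⊤ →
        ∃ (K : GrModFP 𝒜) (f : K ⟶ M.quotient N hN), P K ∧ GrMod.lin f.hom ≠ 0) : P M := by
  have : Module.FinitePresentation A M.obj.carrier := M.property
  obtain ⟨N, ⟨hN, hle, hPN⟩, hmax⟩ := set_has_maximal_iff_noetherian.2
    (inferInstance : IsNoetherian A M.obj.carrier)
    {N | ∃ hN : ∀ i, ∀ m ∈ N, M.obj.proj i m ∈ N, N₀ ≤ N ∧ P (M.sub N hN)}
    ⟨N₀, h₀, le_rfl, hP₀⟩
  by_cases htop : N = ⊤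
  · subst htop
    let g : M.sub ⊤ hN ⟶ M :=
      ObjectProperty.homMk (GrMod.mkHom (⊤ : Submodule A M.obj.carrier).subtype fun _ _ hm => hm)
    have : Epi g := GrModFP.epi_of_surjective g fun m => ⟨⟨m, trivial⟩, rfl⟩
    exact P.prop_of_epi g hPN
  · exfalso
    obtain ⟨K, f, hK, hf⟩ := hstep N hN hle htop
    let F : K.obj.carrier →ₗ[A] M.obj.carrier ⧸ N := GrMod.lin f.hom
    let N' : Submodule A M.obj.carrier := (LinearMap.range F).comap N.mkQ
    let π : M.obj ⟶ M.obj.quotient N hN := GrMod.mkHom N.mkQ fun _ m hm => ⟨m, hm, rfl⟩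
    have hN' : ∀ i, ∀ m ∈ N', M.obj.proj i m ∈ N' := by
      intro i m hm
      have h1 := GrMod.range_proj f.hom i (N.mkQ m) hm
      have h2 : (M.obj.quotient N hN).proj i (N.mkQ m) = N.mkQ (M.obj.proj i m) :=
        GrMod.lin_proj π i m
      rw [h2] at h1
      exact h1
    have hNN' : N ≤ N' := by
      intro m hm
      change N.mkQ m ∈ LinearMap.range F
      have h1 : N.mkQ m = 0 := (Submodule.Quotient.mk_eq_zero N).2 hm
      rw [h1]
      exact Submodule.zero_mem _
    have hlt : N < N' := by
      refine lt_of_le_of_ne hNN' fun h => hf (LinearMap.ext fun x => ?_)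
      obtain ⟨m, hm⟩ := N.mkQ_surjective (F x)
      have h1 : m ∈ N' := ⟨x, hm.symm⟩
      rw [← h] at h1
      exact hm.symm.trans ((Submodule.Quotient.mk_eq_zero N).2 h1)
    refine hmax N' ⟨hN', hle.trans hNN', ?_⟩ hlt
    let R := (M.quotient N hN).sub (LinearMap.range F) (GrMod.range_proj f.hom)
    let p : K ⟶ R := ObjectProperty.homMk (GrMod.mkHom F.rangeRestrict
      fun _ _ hm => GrMod.lin_mem f.hom hm)
    have : Epi p := GrModFP.epi_of_surjective p F.surjective_rangeRestrict
    let a : M.sub N hN ⟶ M.sub N' hN' := ObjectProperty.homMk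
      (GrMod.mkHom (Submodule.inclusion hNN') fun _ _ hm => hm)
    let b : M.sub N' hN' ⟶ R := ObjectProperty.homMk
      (GrMod.mkHom (N.mkQ.restrict fun _ hm => hm) fun _ m hm => ⟨m.1, hm, rfl⟩)
    have hab : a ≫ b = 0 := by
      apply ObjectProperty.hom_ext
      apply GrMod.hom_ext
      refine LinearMap.ext fun m => Subtype.ext ?_
      exact (Submodule.Quotient.mk_eq_zero N).2 m.2
    refine P.prop_X₂_of_exact (S := ShortComplex.mk a b hab) ?_ hPN (P.prop_of_epi p hK)
    rw [GrModFP.exact_iff]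
    intro y hy
    have h1 : N.mkQ y.1 = 0 := congrArg Subtype.val hy
    exact ⟨⟨y.1, (Submodule.Quotient.mk_eq_zero N).1 h1⟩, rfl⟩

/-- If `A` is finite over `A_H`, then a Serre class contains all modules with finite dimensional
restriction to `H` as soon as it contains the finite dimensional ones and has an object with a
nonzero morphism to each nonzero module with zero restriction. -/
theorem prop_of_restr_finDim [IsGradedAlgebra 𝒜] (H : AddSubgroup ι)
    [Module.Finite (restrAlg 𝒜 H) A]
    (P : ObjectProperty (GrModFP 𝒜)) [P.IsSerreClass] (hfd : finDimFP 𝒜 ≤ P)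
    (hstep : ∀ M : GrModFP 𝒜, Nontrivial M.obj.carrier → (∀ h ∈ H, M.obj.deg h = ⊥) →
      ∃ (K : GrModFP 𝒜) (f : K ⟶ M), P K ∧ GrMod.lin f.hom ≠ 0)
    (M : GrModFP 𝒜) (hM : finDimFP (restrGrading 𝒜 H) ((restrFP 𝒜 H).obj M)) : P M := by
  let s : Set M.obj.carrier := {m | ∃ h : H, m ∈ M.obj.deg h}
  let N₀ := Submodule.span A s
  have h₀ : ∀ i, ∀ m ∈ N₀, M.obj.proj i m ∈ N₀ :=
    M.obj.span_proj s fun m ⟨h, hm⟩ => ⟨h, hm⟩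
  refine prop_of_exists_hom_to_quotient P M N₀ h₀ (hfd _ ?_) ?_
  · change Module.Finite k N₀
    have hfin : Module.Finite k (M.obj.restrSubmodule H) := hM
    obtain ⟨r, g, hg⟩ := Module.Finite.exists_fin' (restrAlg 𝒜 H) A
    -- `A` is generated by the `c j` over `A_H`, so `N₀` is the sum of the `c j • M_H`
    let c : Fin r → A := fun j => g fun i => if j = i then 1 else 0
    have hc : ∀ a : A, ∃ b : Fin r → restrAlg 𝒜 H, a = ∑ j, (b j : A) * c j := by
      intro a
      obtain ⟨b, rfl⟩ := hg a
      refine ⟨b, ?_⟩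
      conv_lhs => rw [LinearMap.pi_apply_eq_sum_univ g b]
      rfl
    let Φ : (Fin r → M.obj.restrSubmodule H) →ₗ[k] M.obj.carrier :=
      { toFun := fun v => ∑ j, c j • (v j : M.obj.carrier)
        map_add' := fun v w => by simp [smul_add, Finset.sum_add_distrib]
        map_smul' := fun x v => by
          simp only [RingHom.id_apply, Finset.smul_sum]
          exact Finset.sum_congr rfl fun j _ => smul_comm (c j) x (v j : M.obj.carrier) }
    have hΦ : ∀ (a : A) (m : M.obj.restrSubmodule H),
        a • (m : M.obj.carrier) ∈ LinearMap.range Φ := by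
      intro a m
      obtain ⟨b, rfl⟩ := hc a
      refine ⟨fun j => b j • m, ?_⟩
      change ∑ j, c j • ((b j : A) • (m : M.obj.carrier)) = _
      rw [Finset.sum_smul]
      exact Finset.sum_congr rfl fun j _ => by rw [smul_smul, mul_comm]
    have hle : N₀.restrictScalars k ≤ LinearMap.range Φ := by
      intro m hm
      refine Submodule.span_induction (p := fun m _ => m ∈ LinearMap.range Φ) ?_ ?_ ?_ ?_ hm
      · rintro m ⟨h, hm⟩
        simpa using hΦ 1 ⟨m, Submodule.mem_iSup_of_mem h hm⟩
      · exact Submodule.zero_mem _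
      · exact fun _ _ _ _ hx hy => Submodule.add_mem _ hx hy
      · rintro a _ _ ⟨v, rfl⟩
        change a • ∑ j, c j • (v j : M.obj.carrier) ∈ _
        rw [Finset.smul_sum]
        refine Submodule.sum_mem _ fun j _ => ?_
        rw [smul_smul]
        exact hΦ _ _
    exact Module.Finite.of_injective (Submodule.inclusion hle) (Submodule.inclusion_injective hle)
  · intro N hN hle htop
    refine hstep (M.quotient N hN) (Submodule.Quotient.nontrivial_iff.2 htop) fun h hh => ?_
    rw [eq_bot_iff]
    rintro _ ⟨m, hm, rfl⟩
    exact (Submodule.Quotient.mk_eq_zero N).2 (hle (Submodule.subset_span ⟨⟨h, hh⟩, hm⟩))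

end GrModFP

end Devissage

/-! ### The string group -/

/-- In a linear combination, one summand may be moved to another index if it is a multiple of the
generator there. -/
theorem Finset.sum_zsmul_exchange {G ι : Type*} [AddCommGroup G] [Fintype ι] [DecidableEq ι]
    (x : ι → G) (a : ι → ℤ) (i j : ι) (b : ℤ) (h : a i • x i = b • x j) :
    ∑ r, a r • x r = ∑ r, (a - Pi.single i (a i) + Pi.single j b : ι → ℤ) r • x r := by
  simp [add_smul, sub_smul, Finset.sum_add_distrib, Finset.sum_sub_distrib, Pi.single_apply,
    ite_smul, h]

namespace WeightedLine

variable {k : Type u} [Field k] (X : WeightedLine k)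

theorem exists_ne_index (i : Fin X.t) : ∃ j, j ≠ i := by
  have : Nontrivial (Fin X.t) := Fin.nontrivial_iff_two_le.2 X.two_le
  exact exists_ne i

theorem exists_eq_sum_zsmul_xvec (g : X.StringGroup) :
    ∃ a : Fin X.t → ℤ, g = ∑ i, a i • X.xvec i := by
  obtain ⟨a, rfl⟩ := QuotientAddGroup.mk_surjective g
  refine ⟨a, ?_⟩
  have h : a = ∑ i, a i • (Pi.single i 1 : Fin X.t → ℤ) := by
    ext j
    simp [Pi.single_apply]
  conv_lhs => rw [h]
  change QuotientAddGroup.mk' X.stringRel _ = _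
  rw [map_sum]
  exact Finset.sum_congr rfl fun i _ => map_zsmul (QuotientAddGroup.mk' X.stringRel) _ _

theorem piHom_sum (i : Fin X.t) (a : Fin X.t → ℤ) :
    X.piHom i (∑ j, a j • X.xvec j) = (a i : ZMod (X.p i)) := by
  simp [map_sum, piHom_xvec]

/-- The kernel of `π_i` is generated by the `x_j` with `j ≠ i`. -/
theorem exists_eq_sum_of_piHom_eq_zero (i : Fin X.t) (g : X.StringGroup) (hg : X.piHom i g = 0) :
    ∃ a : Fin X.t → ℤ, a i = 0 ∧ g = ∑ j, a j • X.xvec j := by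
  classical
  obtain ⟨a, rfl⟩ := X.exists_eq_sum_zsmul_xvec g
  rw [piHom_sum, ZMod.intCast_zmod_eq_zero_iff_dvd] at hg
  obtain ⟨b, hb⟩ := hg
  obtain ⟨j, hj⟩ := X.exists_ne_index i
  -- `a_i x_i = b p_i x_i = b p_j x_j`
  refine ⟨a - Pi.single i (a i) + Pi.single j (b * X.p j), by simp [hj.symm], ?_⟩
  refine Finset.sum_zsmul_exchange X.xvec a i j _ ?_
  rw [hb, mul_comm, mul_smul, mul_smul, natCast_zsmul, natCast_zsmul, X.nsmul_xvec i j]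

/-- An element that is killed by all `π_i` is a multiple of `p_j x_j`. -/
theorem exists_eq_zsmul_of_piHom_eq_zero (g : X.StringGroup) (hg : ∀ i, X.piHom i g = 0) :
    ∃ b : ℤ, ∀ j, g = b • X.p j • X.xvec j := by
  obtain ⟨a, rfl⟩ := X.exists_eq_sum_zsmul_xvec g
  have h1 : ∀ i, ∃ b : ℤ, a i = X.p i * b := by
    intro i
    have := hg i
    rwa [piHom_sum, ZMod.intCast_zmod_eq_zero_iff_dvd] at this
  choose b hb using h1
  refine ⟨∑ i, b i, fun j => ?_⟩
  have hsum : (∑ i, b i) • X.p j • X.xvec j = ∑ i, b i • X.p j • X.xvec j :=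
    map_sum (zmultiplesHom X.StringGroup (X.p j • X.xvec j)) b Finset.univ
  rw [hsum]
  refine Finset.sum_congr rfl fun i _ => ?_
  rw [hb, mul_comm, mul_smul, natCast_zsmul, X.nsmul_xvec i j]

variable {X} {H : AddSubgroup X.StringGroup}

/-- An infinite subgroup contains a positive multiple of the canonical element `p_i x_i`: it meets
the kernel of the homomorphism `(π_i)_i` to a finite group. -/
theorem exists_nsmul_mem (hH : Infinite H) :
    ∃ n : ℕ, 0 < n ∧ ∀ i, n • X.p i • X.xvec i ∈ H := by
  have : ∀ i, NeZero (X.p i) := fun i => ⟨(Nat.lt_of_succ_le (X.one_le_p i)).ne'⟩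
  obtain ⟨g, h, hne, hgh⟩ := Finite.exists_ne_map_eq_of_infinite
    fun (h : H) (i : Fin X.t) => X.piHom i h
  obtain ⟨b, hb⟩ := X.exists_eq_zsmul_of_piHom_eq_zero ((g : X.StringGroup) - h) fun i => by
    rw [map_sub, sub_eq_zero]
    exact congrFun hgh i
  have hb0 : b ≠ 0 := by
    rintro rfl
    have := hb ⟨0, by have := X.two_le; omega⟩
    rw [zero_smul, sub_eq_zero] at this
    exact hne (Subtype.ext this)
  refine ⟨b.natAbs, Int.natAbs_pos.2 hb0, fun i => ?_⟩
  have hmem : b • X.p i • X.xvec i ∈ H := by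
    rw [← hb i]
    exact H.sub_mem g.2 h.2
  rw [← natCast_zsmul]
  rcases Int.natAbs_eq b with h | h
  · rwa [← h]
  · rw [show ((b.natAbs : ℕ) : ℤ) = -b by omega, neg_smul]
    exact H.neg_mem hmem

/-- Every element is congruent modulo an infinite subgroup `H` to the degree of a monomial, one in
which no new variables occur. -/
theorem exists_nsmul_add_mem (hH : Infinite H) (a : Fin X.t → ℤ) :
    ∃ u : Fin X.t → ℕ, (∀ i, a i = 0 → u i = 0) ∧
      ∑ i, u i • X.xvec i - ∑ i, a i • X.xvec i ∈ H := by
  obtain ⟨n, hn, hnH⟩ := exists_nsmul_mem hH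
  have hpos : ∀ i, 0 ≤ a i + |a i| * (n * X.p i) := by
    intro i
    have h1 : 1 ≤ (n * X.p i : ℤ) := by
      exact_mod_cast Nat.mul_pos hn (X.one_le_p i)
    nlinarith [neg_abs_le (a i), abs_nonneg (a i)]
  refine ⟨fun i => (a i + |a i| * (n * X.p i)).toNat, fun i hi => by simp [hi], ?_⟩
  rw [← Finset.sum_sub_distrib]
  refine H.sum_mem fun i _ => ?_
  rw [← natCast_zsmul, Int.toNat_of_nonneg (hpos i), add_zsmul, add_sub_cancel_left, mul_smul,
    mul_smul, natCast_zsmul, natCast_zsmul]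
  exact H.zsmul_mem (hnH i) _

end WeightedLine

/-! ### The homogeneous coordinate algebra -/

/-- An algebra generated over `k` by finitely many elements that are integral over an intermediate
ring is finite over that ring. -/
theorem MvPolynomial.finite_of_surjective_of_isIntegral {k R B σ : Type*} [CommRing k] [CommRing R]
    [CommRing B] [Algebra k R] [Algebra k B] [Algebra R B] [IsScalarTower k R B] [Finite σ]
    (φ : MvPolynomial σ k →ₐ[k] B) (hφ : Function.Surjective φ)
    (h : ∀ i, IsIntegral R (φ (MvPolynomial.X i))) : Module.Finite R B := by
  have h1 : Algebra.FiniteType k B := Algebra.FiniteType.of_surjective φ hφ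
  have h2 : Algebra.FiniteType R B := Algebra.FiniteType.of_restrictScalars_finiteType k R B
  have h3 : Algebra.IsIntegral R B := by
    refine ⟨fun b => ?_⟩
    obtain ⟨f, rfl⟩ := hφ b
    induction f using MvPolynomial.induction_on with
    | C a =>
      rw [show φ (MvPolynomial.C a) = algebraMap R B (algebraMap k R a) by
        rw [← IsScalarTower.algebraMap_apply]; exact φ.commutes a]
      exact isIntegral_algebraMap
    | add f g hf hg => rw [map_add]; exact hf.add hg
    | mul_X f i hf => rw [map_mul]; exact hf.mul (h i)
  exact Algebra.IsIntegral.finite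

theorem Module.Finite.of_smul_eq_zero {k R V : Type*} [CommRing k] [CommRing R] [Algebra k R]
    [AddCommGroup V] [Module k V] [Module R V] [IsScalarTower k R V] [Module.Finite R V]
    (I : Ideal R) [Module.Finite k (R ⧸ I)] (h : ∀ a ∈ I, ∀ v : V, a • v = 0) :
    Module.Finite k V := by
  have hV : Module.IsTorsionBySet R V I := fun v a => h a a.2 v
  let _ := hV.module
  have : IsScalarTower k (R ⧸ I) V := hV.isScalarTower
  have : IsScalarTower R (R ⧸ I) V := hV.isScalarTower
  have : Module.Finite (R ⧸ I) V := Module.Finite.of_restrictScalars_finite R _ _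
  exact Module.Finite.trans (R ⧸ I) V

namespace WeightedLine

variable {k : Type u} [Field k] (X : WeightedLine k)

/-- The coordinates `(a, b)` of the linear form `a Y_1 + b Y_2` that vanishes in the point `λ_j`,
namely `Y_1` for `∞` and `Y_2 - λ Y_1` for `λ ∈ k`. -/
def form (j : Fin X.t) : k × k := (X.pt j).elim (1, 0) fun a => (-a, 1)

theorem form_det_ne_zero {i j : Fin X.t} (h : i ≠ j) :
    (X.form i).1 * (X.form j).2 - (X.form j).1 * (X.form i).2 ≠ 0 := by
  have h' := X.pt_injective.ne h
  unfold form
  generalize X.pt i = a at h'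
  generalize X.pt j = b at h'
  induction a using OnePoint.rec <;> induction b using OnePoint.rec
  · exact absurd rfl h'
  · simp
  · simp
  · rename_i a b
    have : a ≠ b := fun e => h' (by rw [e])
    simpa [neg_add_eq_zero, sub_eq_zero] using fun e => this (by simpa using e)

/-- `x_j ^ p_j` is the linear form `form j` in `x_1 ^ p_1` and `x_2 ^ p_2`. -/
theorem x_pow (j : Fin X.t) :
    X.x j ^ X.p j =
      (X.form j).1 • X.x ⟨0, by have := X.two_le; omega⟩ ^ X.p ⟨0, by have := X.two_le; omega⟩ +
      (X.form j).2 • X.x ⟨1, by have := X.two_le; omega⟩ ^ X.p ⟨1, by have := X.two_le; omega⟩ := by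
  have h2 := X.two_le
  rcases j with ⟨_ | _ | j, hj⟩
  · simp [form, X.pt_first]
  · simp [form, X.pt_second]
  · have hne : X.pt ⟨j + 2, hj⟩ ≠ OnePoint.infty := by
      rw [← X.pt_first]
      exact X.pt_injective.ne (by simp [Fin.ext_iff])
    obtain ⟨a, ha⟩ := OnePoint.ne_infty_iff_exists.1 hne
    have hrel : MvPolynomial.X ⟨j + 2, hj⟩ ^ X.p ⟨j + 2, hj⟩ -
        (MvPolynomial.X ⟨1, by omega⟩ ^ X.p ⟨1, by omega⟩ -
          MvPolynomial.C a * MvPolynomial.X ⟨0, by omega⟩ ^ X.p ⟨0, by omega⟩) ∈ X.coordIdeal :=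
      Ideal.subset_span ⟨⟨j + 2, hj⟩, a, by simp, ha.symm, rfl⟩
    have h1 := (Ideal.Quotient.mk_eq_mk_iff_sub_mem _ _).2 hrel
    have h3 : Ideal.Quotient.mk X.coordIdeal (MvPolynomial.C a) = algebraMap k X.CoordAlg a := rfl
    rw [map_pow, map_sub, map_mul, map_pow, map_pow, h3, ← Algebra.smul_def] at h1
    have hf : X.form ⟨j + 1 + 1, hj⟩ = (-a, 1) := by
      unfold form
      rw [← ha]
      rfl
    rw [hf]
    simp only [one_smul, neg_smul]
    refine h1.trans ?_
    rw [sub_eq_neg_add]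
    rfl

/-- All `x_l ^ p_l` lie in the ideal generated by two of the `x_i`. -/
theorem x_pow_mem_span_pair {i j : Fin X.t} (h : i ≠ j) (l : Fin X.t) :
    X.x l ^ X.p l ∈ Ideal.span {X.x i, X.x j} := by
  set y₁ := X.x ⟨0, by have := X.two_le; omega⟩ ^ X.p ⟨0, by have := X.two_le; omega⟩ with hy₁
  set y₂ := X.x ⟨1, by have := X.two_le; omega⟩ ^ X.p ⟨1, by have := X.two_le; omega⟩ with hy₂
  let I := (Ideal.span {X.x i, X.x j}).restrictScalars k
  have hi : (X.form i).1 • y₁ + (X.form i).2 • y₂ ∈ I := by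
    rw [← X.x_pow i]
    exact Ideal.pow_mem_of_mem _ (Ideal.subset_span (by simp)) _ (X.one_le_p i)
  have hj : (X.form j).1 • y₁ + (X.form j).2 • y₂ ∈ I := by
    rw [← X.x_pow j]
    exact Ideal.pow_mem_of_mem _ (Ideal.subset_span (by simp)) _ (X.one_le_p j)
  have hd := X.form_det_ne_zero h
  set D := (X.form i).1 * (X.form j).2 - (X.form j).1 * (X.form i).2
  -- Cramer's rule
  have h1 : y₁ ∈ I := by
    rw [← I.smul_mem_iff hd]
    convert I.sub_mem (I.smul_mem (X.form j).2 hi) (I.smul_mem (X.form i).2 hj) using 1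
    module
  have h2 : y₂ ∈ I := by
    rw [← I.smul_mem_iff hd]
    convert I.sub_mem (I.smul_mem (X.form i).1 hj) (I.smul_mem (X.form j).1 hi) using 1
    module
  rw [X.x_pow l]
  exact I.add_mem (I.smul_mem _ h1) (I.smul_mem _ h2)

/-- A finite module that is killed by two of the `x_i` is finite dimensional. -/
theorem finite_of_smul_eq_zero {i j : Fin X.t} (h : i ≠ j) {V : Type*} [AddCommGroup V]
    [Module k V] [Module X.CoordAlg V] [IsScalarTower k X.CoordAlg V] [Module.Finite X.CoordAlg V]
    (hi : ∀ v : V, X.x i • v = 0) (hj : ∀ v : V, X.x j • v = 0) : Module.Finite k V := by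
  let I : Ideal X.CoordAlg := Ideal.span {X.x i, X.x j}
  have hI : Module.Finite k (X.CoordAlg ⧸ I) := by
    let φ := (Ideal.Quotient.mkₐ k I).comp (Ideal.Quotient.mkₐ k X.coordIdeal)
    have hφ : Function.Surjective φ :=
      (Ideal.Quotient.mkₐ_surjective k I).comp (Ideal.Quotient.mkₐ_surjective k X.coordIdeal)
    have hint : ∀ l, IsIntegral k (φ (MvPolynomial.X l)) := by
      intro l
      refine IsIntegral.of_pow (Nat.lt_of_succ_le (X.one_le_p l)) ?_
      have h0 : φ (MvPolynomial.X l) ^ X.p l = 0 := by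
        change Ideal.Quotient.mk I (X.x l) ^ X.p l = 0
        rw [← map_pow]
        exact Ideal.Quotient.eq_zero_iff_mem.2 (X.x_pow_mem_span_pair h l)
      rw [h0]
      exact isIntegral_zero
    exact MvPolynomial.finite_of_surjective_of_isIntegral (k := k) (R := k) (σ := Fin X.t)
      (B := X.CoordAlg ⧸ I) φ hφ hint
  have htors : ∀ a ∈ I, ∀ v : V, a • v = 0 := by
    intro a ha v
    have hle : I ≤ LinearMap.ker (LinearMap.toSpanSingleton X.CoordAlg V v) := by
      rw [Ideal.span_le]
      rintro _ (rfl | rfl)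
      · exact hi v
      · exact hj v
    exact hle ha
  exact Module.Finite.of_smul_eq_zero I htors

/-- `S` is finite over `S_H`, because `H` contains the degree of a power of each `x_i`. -/
theorem finite_over_restrAlg {H : AddSubgroup X.StringGroup} (hH : Infinite H) :
    Module.Finite (restrAlg X.grading H) X.CoordAlg := by
  obtain ⟨n, hn, hnH⟩ := exists_nsmul_mem hH
  refine MvPolynomial.finite_of_surjective_of_isIntegral (R := restrAlg X.grading H)
    (Ideal.Quotient.mkₐ k X.coordIdeal)
    (Ideal.Quotient.mkₐ_surjective k X.coordIdeal) fun i => ?_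
  refine IsIntegral.of_pow (Nat.mul_pos hn (X.one_le_p i)) ?_
  have hmem : X.x i ^ (n * X.p i) ∈ restrAlg X.grading H := by
    refine Submodule.mem_iSup_of_mem (⟨_, hnH i⟩ : H) ?_
    have := SetLike.pow_mem_graded (n * X.p i) (X.x_mem i)
    rwa [mul_smul] at this
  exact isIntegral_algebraMap (R := restrAlg X.grading H) (x := ⟨_, hmem⟩)

/-- If `π_i(g) ≠ 0`, then all elements of degree `g` are divisible by `x_i`. -/
theorem grading_le_span_of_piHom_ne_zero (i : Fin X.t) (g : X.StringGroup)
    (hg : X.piHom i g ≠ 0) {a : X.CoordAlg} (ha : a ∈ X.grading g) : a ∈ Ideal.span {X.x i} := by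
  obtain ⟨f, hf, rfl⟩ := ha
  have h1 : f ∈ Ideal.span ((MvPolynomial.X : Fin X.t → MvPolynomial (Fin X.t) k) '' {i}) := by
    rw [MvPolynomial.mem_ideal_span_X_image]
    intro d hd
    refine ⟨i, rfl, fun hdi => hg ?_⟩
    rw [← hf (MvPolynomial.mem_support_iff.1 hd), Finsupp.weight_apply,
      Finsupp.sum_fintype _ _ (by simp)]
    simp [piHom_xvec, hdi]
  rw [Set.image_singleton] at h1
  obtain ⟨b, rfl⟩ := Ideal.mem_span_singleton'.1 h1
  exact Ideal.mem_span_singleton'.2 ⟨Ideal.Quotient.mk _ b, (map_mul _ _ _).symm⟩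

end WeightedLine

/-! ### Cyclic graded modules -/

section Cyclic

variable {k A : Type u} [Field k] [CommRing A] [Algebra k A] {ι : Type v} [AddCommGroup ι]
  {𝒜 : ι → Submodule k A} [IsGradedAlgebra 𝒜]

/-- The morphism `(A / (a))(-g) ⟶ M` given by an element of degree `g` that is killed by `a`. -/
def GrMod.ofElement (M : GrMod 𝒜) {j : ι} {a : A} (ha : a ∈ 𝒜 j) {g : ι} {m : M.carrier}
    (hm : m ∈ M.deg g) (ham : a • m = 0) : (GrMod.quotSpan ha).shift (-g) ⟶ M :=
  GrMod.mkHom ((Submodule.span A {a} : Submodule A A).liftQ (LinearMap.toSpanSingleton A _ m) (by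
    rw [Submodule.span_le]
    rintro _ rfl
    exact ham)) (by
    rintro i _ ⟨b, hb, rfl⟩
    have h := M.smul_mem hb hm
    rwa [show -g + i + g = i by abel] at h)

theorem GrMod.ofElement_ne_zero (M : GrMod 𝒜) {j : ι} {a : A} (ha : a ∈ 𝒜 j) {g : ι}
    {m : M.carrier} (hm : m ∈ M.deg g) (ham : a • m = 0) (hm0 : m ≠ 0) :
    GrMod.lin (M.ofElement ha hm ham) ≠ 0 := by
  intro h
  apply hm0
  rw [← one_smul A m]
  exact LinearMap.congr_fun h (Submodule.Quotient.mk (1 : A))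

/-- Multiplication by an element `b` of degree `d`, as a morphism `M(y) ⟶ M(y + d)`. -/
def GrMod.mulShift (M : GrMod 𝒜) {d : ι} {b : A} (hb : b ∈ 𝒜 d) (y : ι) :
    M.shift y ⟶ M.shift (y + d) :=
  GrMod.mkHom (LinearMap.lsmul A M.carrier b) fun i m hm => by
    have h := M.smul_mem hb hm
    rwa [show d + (y + i) = y + d + i by abel] at h

theorem GrMod.smul_quotSpan_eq_zero {j : ι} {a : A} (ha : a ∈ 𝒜 j)
    (v : (GrMod.quotSpan ha).carrier) : a • v = 0 := by
  obtain ⟨b, rfl⟩ := Submodule.mkQ_surjective (Submodule.span A {a} : Submodule A A) v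
  refine (Submodule.Quotient.mk_eq_zero (Submodule.span A {a} : Submodule A A)).2 ?_
  exact Submodule.mem_span_singleton.2 ⟨b, mul_comm (b : A) a⟩

end Cyclic

namespace WeightedLine

variable {k : Type u} [Field k] (X : WeightedLine k)

/-! ### The Serre subcategory `N_H` -/

/-- The finitely presented module `(S / (x_i))(y)`. -/
noncomputable abbrev cyclic (i : Fin X.t) (y : X.StringGroup) : GrModFP X.grading :=
  ⟨(GrMod.quotSpan (X.x_mem i)).shift y, quotSpan_shift_isFinPres _ _⟩

/-- Kernel and cokernel of the multiplication with `x_j` on `S / (x_i)`, `i ≠ j`, are killed by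
`x_i` and `x_j`; so this multiplication is an isomorphism in the quotient category. -/
theorem isoModSerre_mulShift {i j : Fin X.t} (h : i ≠ j) (y : X.StringGroup) :
    (finDimFP X.grading).isoModSerre (X := X.cyclic i y) (Y := X.cyclic i (y + X.xvec j))
      (ObjectProperty.homMk ((GrMod.quotSpan (X.x_mem i)).mulShift (X.x_mem j) y)) := by
  rw [isoModSerre_finDimFP_iff]
  let V := (GrMod.quotSpan (X.x_mem i)).carrier
  have hV : Module.Finite X.CoordAlg V := inferInstanceAs
    (Module.Finite X.CoordAlg (X.CoordAlg ⧸ (Submodule.span X.CoordAlg {X.x i} : Submodule _ _)))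
  have hi : ∀ v : V, X.x i • v = 0 := GrMod.smul_quotSpan_eq_zero (X.x_mem i)
  let F : V →ₗ[X.CoordAlg] V := LinearMap.lsmul X.CoordAlg V (X.x j)
  constructor
  · change Module.Finite k (LinearMap.ker F)
    exact X.finite_of_smul_eq_zero h (fun v => Subtype.ext (hi v)) (fun v => Subtype.ext v.2)
  · change Module.Finite k (V ⧸ LinearMap.range F)
    refine X.finite_of_smul_eq_zero h (fun v => ?_) (fun v => ?_)
    · obtain ⟨v, rfl⟩ := Submodule.mkQ_surjective _ v
      rw [← map_smul, hi, map_zero]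
    · obtain ⟨v, rfl⟩ := Submodule.mkQ_surjective _ v
      rw [← map_smul]
      exact (Submodule.Quotient.mk_eq_zero _).2 ⟨v, rfl⟩

/-- In the quotient category, `(S / (x_i))(y)` depends only on `π_i(y)`. -/
theorem prop_cyclic_iff (P : ObjectProperty (QMod X.grading)) [P.IsClosedUnderIsomorphisms]
    (i : Fin X.t) (y z : X.StringGroup) (h : X.piHom i y = X.piHom i z) :
    P ((qFunctor X.grading).obj (X.cyclic i y)) ↔ P ((qFunctor X.grading).obj (X.cyclic i z)) := by
  let T : AddSubgroup X.StringGroup :=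
    { carrier := {w | ∀ y, P ((qFunctor X.grading).obj (X.cyclic i y)) ↔
        P ((qFunctor X.grading).obj (X.cyclic i (y + w)))}
      zero_mem' := fun y => by rw [add_zero]
      add_mem' := fun {v w} hv hw y => by rw [hv y, hw (y + v), add_assoc]
      neg_mem' := fun {w} hw y => by rw [hw (y + -w), neg_add_cancel_right] }
  have hT : ∀ j, j ≠ i → X.xvec j ∈ T := by
    intro j hj y
    have := Localization.inverts (qFunctor X.grading) _ _ (X.isoModSerre_mulShift hj.symm y)
    exact P.prop_iff_of_iso (asIso ((qFunctor X.grading).map (ObjectProperty.homMk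
      ((GrMod.quotSpan (X.x_mem i)).mulShift (X.x_mem j) y))))
  obtain ⟨a, hai, ha⟩ := X.exists_eq_sum_of_piHom_eq_zero i (z - y)
    (by rw [map_sub, h, sub_self])
  have hmem : z - y ∈ T := by
    rw [ha]
    refine T.sum_mem fun j _ => ?_
    by_cases hj : j = i
    · rw [hj, hai, zero_smul]
      exact T.zero_mem
    · exact T.zsmul_mem (hT j hj) _
  have := hmem y
  rwa [add_sub_cancel] at this

variable {X} {H : AddSubgroup X.StringGroup}

theorem kernelSerre_cyclic (i : Fin X.t) (y : X.StringGroup)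
    (hy : -X.piHom i y ∉ H.map (X.piHom i)) :
    X.kernelSerre H ((qFunctor X.grading).obj (X.cyclic i y)) := by
  have : NeZero (X.p i) := ⟨(Nat.lt_of_succ_le (X.one_le_p i)).ne'⟩
  rw [X.prop_cyclic_iff (X.kernelSerre H) i y ((X.piHom i y).val • X.xvec i) (by simp [piHom_xvec])]
  refine fun Q _ hQ => hQ _ ⟨i, (X.piHom i y).val, Nat.le_sub_one_of_lt (ZMod.val_lt _), ?_, rfl⟩
  rwa [ZMod.natCast_zmod_val]

/-- If `-π_i(y) ∉ π_i(H)`, then the restriction of `(S / (x_i))(y)` even vanishes: its component of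
degree `h` comes from elements of `S` of degree `y + h`, which are divisible by `x_i` since
`π_i(y + h) ≠ 0`. -/
theorem finDimFP_restr_cyclic (i : Fin X.t) (y : X.StringGroup)
    (hy : -X.piHom i y ∉ H.map (X.piHom i)) :
    finDimFP (restrGrading X.grading H) ((restrFP X.grading H).obj (X.cyclic i y)) := by
  have hdeg : ∀ h : H, (X.cyclic i y).obj.deg h = ⊥ := by
    intro h
    rw [eq_bot_iff]
    rintro _ ⟨a, ha, rfl⟩
    refine (Submodule.Quotient.mk_eq_zero _).2 ?_
    refine X.grading_le_span_of_piHom_ne_zero i (y + h) (fun h0 => hy ?_) ha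
    rw [map_add] at h0
    exact ⟨h, h.2, (neg_eq_of_add_eq_zero_right h0).symm⟩
  have hbot : partIn H (X.cyclic i y).obj.deg = ⊥ := by
    rw [partIn, iSup_eq_bot]
    exact hdeg
  change Module.Finite k ((X.cyclic i y).obj.restrSubmodule H)
  have : Subsingleton ((X.cyclic i y).obj.restrSubmodule H) := by
    refine subsingleton_of_forall_eq 0 fun m => Subtype.ext ?_
    have := m.2
    change m.1 ∈ partIn H _ at this
    rw [hbot] at this
    exact (Submodule.mem_bot k).1 this
  infer_instance

/-- A property of elements of a module that is inherited from `m` to `x_i m` for all `i` in `I`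
is inherited by the multiples of `m` by monomials in the `x_i`, `i ∈ I`. -/
theorem prop_monomial_smul {V : Type*} [AddCommGroup V] [Module X.CoordAlg V] (P : V → Prop)
    (I : Set (Fin X.t)) (hP : ∀ i ∈ I, ∀ m, P m → P (X.x i • m)) (u : Fin X.t → ℕ)
    (hu : ∀ i, i ∉ I → u i = 0) (m : V) (hm : P m) : P ((∏ i, X.x i ^ u i) • m) := by
  classical
  have hpow : ∀ i ∈ I, ∀ n : ℕ, ∀ m, P m → P (X.x i ^ n • m) := by
    intro i hi n m hm
    induction n with
    | zero => simpa using hm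
    | succ n ih => rw [pow_succ', mul_smul]; exact hP i hi _ ih
  induction (Finset.univ : Finset (Fin X.t)) using Finset.induction_on with
  | empty => simpa using hm
  | insert i s hi ih =>
    rw [Finset.prod_insert hi, mul_smul]
    by_cases hiI : i ∈ I
    · exact hpow i hiI _ _ ih
    · rwa [hu i hiI, pow_zero, one_smul]

/-- Every nonzero module `M` with `M_H = 0` receives a nonzero morphism from an object of `N_H`.
A nonzero homogeneous element has a nonzero multiple `m'` with `x_i m' = 0` for some `i`. If its
degree `g'` has `π_i(g') ∉ π_i(H)`, then `m'` gives a morphism from `(S / (x_i))(-g')`. Otherwise a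
multiple of `m'` is killed by two of the variables and generates a finite dimensional module. -/
theorem exists_hom_of_restr_eq_zero (hH : Infinite H) (M : GrModFP X.grading)
    (hM : Nontrivial M.obj.carrier) (hMH : ∀ h ∈ H, M.obj.deg h = ⊥) :
    ∃ (K : GrModFP X.grading) (f : K ⟶ M),
      X.kernelSerre H ((qFunctor X.grading).obj K) ∧ GrMod.lin f.hom ≠ 0 := by
  have hmon : ∀ u : Fin X.t → ℕ, ∏ i, X.x i ^ u i ∈ X.grading (∑ i, u i • X.xvec i) := fun u =>
    SetLike.prod_mem_graded X.grading (fun i => u i • X.xvec i) (fun i => X.x i ^ u i)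
      fun i _ => SetLike.pow_mem_graded (u i) (X.x_mem i)
  let P : M.obj.carrier → Prop := fun m => m ≠ 0 ∧ ∃ g, m ∈ M.obj.deg g
  have hPx : ∀ i m, P m → X.x i • m ≠ 0 → P (X.x i • m) := fun i m ⟨_, g, hg⟩ h =>
    ⟨h, _, M.obj.smul_mem (X.x_mem i) hg⟩
  -- an element of degree `g` is killed by a monomial of degree in `H - g`, for which one may choose
  -- the variables that occur in any expression of an element of `H - g` by the generators
  have hkill : ∀ (g h : X.StringGroup), h ∈ H → ∀ m ∈ M.obj.deg g, ∀ a : Fin X.t → ℤ,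
      h - g = ∑ i, a i • X.xvec i →
        ∃ u : Fin X.t → ℕ, (∀ i, a i = 0 → u i = 0) ∧ (∏ i, X.x i ^ u i) • m = 0 := by
    intro g h hh m hm a ha
    obtain ⟨u, hu, huH⟩ := exists_nsmul_add_mem hH a
    refine ⟨u, hu, ?_⟩
    have h1 := M.obj.smul_mem (hmon u) hm
    have h2 : ∑ i, u i • X.xvec i + g ∈ H := by
      rw [← ha] at huH
      have := H.add_mem huH hh
      rwa [show ∑ i, u i • X.xvec i - (h - g) + h = ∑ i, u i • X.xvec i + g by abel] at this
    rw [hMH _ h2] at h1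
    exact (Submodule.mem_bot k).1 h1
  obtain ⟨g, m, hm, hm0⟩ := M.obj.exists_homogeneous_ne_zero hM
  obtain ⟨i, m', ⟨hm0', g', hm'⟩, him'⟩ : ∃ i m', P m' ∧ X.x i • m' = 0 := by
    by_contra! hcon
    obtain ⟨a, ha⟩ := X.exists_eq_sum_zsmul_xvec (0 - g)
    obtain ⟨u, -, hu⟩ := hkill g 0 H.zero_mem m hm a ha
    exact (prop_monomial_smul P Set.univ (fun i _ m hm => hPx i m hm (hcon i m hm)) u
      (fun i hi => absurd trivial hi) m ⟨hm0, g, hm⟩).1 hu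
  by_cases hg' : X.piHom i g' ∈ H.map (X.piHom i)
  · -- then some monomial without `x_i` kills `m'`, so a multiple is killed by two variables
    obtain ⟨h, hh, hhg⟩ := hg'
    obtain ⟨a, hai, ha⟩ := X.exists_eq_sum_of_piHom_eq_zero i (h - g')
      (by rw [map_sub, hhg, sub_self])
    obtain ⟨u, hu, hum⟩ := hkill g' h hh m' hm' a ha
    obtain ⟨j, hj, m'', ⟨⟨hm0'', g'', hm''⟩, him''⟩, hjm''⟩ :
        ∃ j ≠ i, ∃ m'', (P m'' ∧ X.x i • m'' = 0) ∧ X.x j • m'' = 0 := by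
      by_contra! hcon
      refine (prop_monomial_smul (fun m => P m ∧ X.x i • m = 0) {i}ᶜ (fun j hj m hm => ?_) u
        (fun j hj => ?_) m' ⟨⟨hm0', g', hm'⟩, him'⟩).1.1 hum
      · exact ⟨hPx j m hm.1 (hcon j hj m hm), by rw [smul_comm, hm.2, smul_zero]⟩
      · rw [Set.notMem_compl_iff.1 hj]
        exact hu i hai
    let f : X.cyclic i (-g'') ⟶ M := ObjectProperty.homMk (M.obj.ofElement (X.x_mem i) hm'' him'')
    let F := GrMod.lin f.hom
    let K : GrModFP X.grading := M.sub (LinearMap.range F) (GrMod.range_proj f.hom)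
    have hK : finDimFP X.grading K := by
      have : Module.Finite X.CoordAlg (LinearMap.range F) :=
        (Module.finitePresentation_iff_finite _ _).1 K.property
      change Module.Finite k (LinearMap.range F)
      have hann : ∀ b : X.CoordAlg, b • m'' = 0 → ∀ v : LinearMap.range F, b • v = 0 := by
        rintro b hb ⟨_, v, rfl⟩
        apply Subtype.ext
        obtain ⟨(c : X.CoordAlg), rfl⟩ := Submodule.mkQ_surjective _ v
        change b • c • m'' = 0
        rw [smul_comm, hb, smul_zero]
      exact X.finite_of_smul_eq_zero hj.symm (hann _ him'') (hann _ hjm'')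
    let e : K ⟶ M := ObjectProperty.homMk (GrMod.mkHom (LinearMap.range F).subtype fun _ _ hm => hm)
    refine ⟨K, e, ?_, fun he => ?_⟩
    · refine (X.kernelSerre H).prop_of_isZero ?_
      rwa [ObjectProperty.SerreClassLocalization.isZero_obj_iff (qFunctor X.grading)
        (finDimFP X.grading)]
    · refine M.obj.ofElement_ne_zero (X.x_mem i) hm'' him'' hm0'' (LinearMap.ext fun v => ?_)
      exact LinearMap.congr_fun he ⟨_, v, rfl⟩
  · refine ⟨X.cyclic i (-g'), ObjectProperty.homMk (M.obj.ofElement (X.x_mem i) hm' him'),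
      kernelSerre_cyclic i _ ?_, M.obj.ofElement_ne_zero (X.x_mem i) hm' him' hm0'⟩
    rwa [map_neg, neg_neg]

theorem kernelSerre_eq_kernel (hH : Infinite H) :
    X.kernelSerre H = (restrQ X.grading H).kernel := by
  apply le_antisymm
  · intro Y hY
    refine hY _ inferInstance ?_
    rintro _ ⟨i, l, -, hl, rfl⟩
    refine (restrQ_kernel_qFunctor_iff X.grading H (X.cyclic i (l • X.xvec i))).2 ?_
    apply finDimFP_restr_cyclic
    simpa [piHom_xvec] using hl
  · intro Y hY
    have : (qFunctor X.grading).EssSurj :=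
      Localization.essSurj _ (finDimFP X.grading).isoModSerre
    let e := (qFunctor X.grading).objObjPreimageIso Y
    refine (X.kernelSerre H).prop_of_iso e ?_
    have hY' := (restrQ X.grading H).kernel.prop_of_iso e.symm hY
    rw [restrQ_kernel_qFunctor_iff] at hY'
    have := X.finite_over_restrAlg hH
    refine GrModFP.prop_of_restr_finDim H ((X.kernelSerre H).inverseImage (qFunctor X.grading))
      (fun M hM => ?_) (exists_hom_of_restr_eq_zero hH) _ hY'
    refine (X.kernelSerre H).prop_of_isZero ?_
    rwa [ObjectProperty.SerreClassLocalization.isZero_obj_iff (qFunctor X.grading)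
        (finDimFP X.grading)]

theorem restrQ_isLocalization_kernelSerre (hH : Infinite H) :
    (restrQ X.grading H).IsLocalization (X.kernelSerre H).isoModSerre :=
  restrQ_isLocalization_of_eq_kernel _ _ _ (kernelSerre_eq_kernel hH)

/-! ### Effective subgroups -/

variable (X) in
/-- The algebra `S / (x_i)` is infinite dimensional: over an algebraic closure, there is a
curve `z ↦ (c_j z ^ n_j)_j` in the zero locus of the defining relations which lies over the point
`λ_i` of the projective line, so that `c_i = 0`. It gives a homomorphism from `S / (x_i)` to a
polynomial ring, with nonconstant elements in its image. -/
theorem not_finite_quotSpan (i : Fin X.t) :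
    ¬ Module.Finite k (X.CoordAlg ⧸ (Submodule.span X.CoordAlg {X.x i} : Submodule _ _)) := by
  intro hfin
  let K := AlgebraicClosure k
  let N := ∏ j, X.p j
  have hN : 0 < N := Finset.prod_pos fun j _ => X.one_le_p j
  have hdvd : ∀ j, X.p j ∣ N := fun j => Finset.dvd_prod_of_mem X.p (Finset.mem_univ j)
  -- the value of `form j` in the point `λ_i`
  let d : Fin X.t → k := fun j =>
    (X.form i).1 * (X.form j).2 - (X.form j).1 * (X.form i).2
  have hroot : ∀ j, ∃ c : K, c ^ X.p j = algebraMap k K (d j) := fun j =>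
    IsAlgClosed.exists_pow_nat_eq _ (X.one_le_p j)
  choose c hc using hroot
  let φ : MvPolynomial (Fin X.t) k →ₐ[k] Polynomial K :=
    MvPolynomial.aeval fun j => Polynomial.C (c j) * Polynomial.X ^ (N / X.p j)
  have hφ : ∀ j, φ (MvPolynomial.X j) ^ X.p j =
      Polynomial.C (algebraMap k K (d j)) * Polynomial.X ^ N := by
    intro j
    rw [MvPolynomial.aeval_X, mul_pow, ← Polynomial.C_pow, hc, ← pow_mul,
      Nat.div_mul_cancel (hdvd j)]
  have hker : ∀ f ∈ X.coordIdeal, φ f = 0 := by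
    intro f hf
    have hle : X.coordIdeal ≤ RingHom.ker φ := by
      rw [coordIdeal, Ideal.span_le]
      rintro _ ⟨j, a, hj, ha, rfl⟩
      change φ _ = 0
      have hfj : X.form j = (-a, 1) := by
        unfold form
        rw [ha]
        rfl
      have hC : φ (MvPolynomial.C a) = Polynomial.C (algebraMap k K a) := by
        rw [MvPolynomial.aeval_C]
        rfl
      rw [map_sub, map_sub, map_mul, map_pow, map_pow, map_pow, hφ, hφ, hφ, hC, ← mul_assoc,
        ← Polynomial.C_mul, ← map_mul, ← sub_mul, ← sub_mul, ← Polynomial.C_sub, ← Polynomial.C_sub,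
        ← map_sub, ← map_sub]
      have h0 : d j - (d ⟨1, by have := X.two_le; omega⟩ -
          a * d ⟨0, by have := X.two_le; omega⟩) = 0 := by
        have h0 : X.form ⟨0, by have := X.two_le; omega⟩ = (1, 0) := by
          simp [form, X.pt_first]
        have h1 : X.form ⟨1, by have := X.two_le; omega⟩ = (0, 1) := by
          simp [form, X.pt_second]
        simp only [d, hfj, h0, h1]
        ring
      rw [h0]
      simp
    exact hle hf
  let ψ : X.CoordAlg →ₐ[k] Polynomial K := Ideal.Quotient.liftₐ X.coordIdeal φ hker
  have hψ : ∀ j, ψ (X.x j) = φ (MvPolynomial.X j) := fun j => rfl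
  have hψi : ψ (X.x i) = 0 := by
    apply eq_zero_of_pow_eq_zero (n := X.p i)
    rw [hψ, hφ]
    simp [d, mul_comm]
  obtain ⟨j, hj⟩ := X.exists_ne_index i
  have hdj : algebraMap k K (d j) ≠ 0 := by
    rw [map_ne_zero]
    exact X.form_det_ne_zero hj.symm
  let I : Ideal X.CoordAlg := Ideal.span {X.x i}
  let χ : X.CoordAlg ⧸ I →ₐ[k] Polynomial K := Ideal.Quotient.liftₐ I ψ fun a ha => by
    obtain ⟨b, rfl⟩ := Ideal.mem_span_singleton'.1 ha
    rw [map_mul, hψi, mul_zero]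
  have hfin' : Module.Finite k (X.CoordAlg ⧸ I) := hfin
  -- so the image of `x_j ^ p_j`, a nonconstant polynomial, would be algebraic over `k`
  obtain ⟨q, hq, hq0⟩ :=
    (Algebra.IsIntegral.isIntegral (R := k) (Ideal.Quotient.mk I (X.x j ^ X.p j))).map χ
  have hχ : χ (Ideal.Quotient.mk I (X.x j ^ X.p j)) =
      Polynomial.C (algebraMap k K (d j)) * Polynomial.X ^ N := by
    change ψ (X.x j ^ X.p j) = _
    rw [map_pow, hψ, hφ]
  rw [hχ] at hq0
  have hcomp : (q.map (algebraMap k K)).comp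
      (Polynomial.C (algebraMap k K (d j)) * Polynomial.X ^ N) = 0 := by
    rw [Polynomial.comp, Polynomial.eval₂_map]
    exact hq0
  rcases Polynomial.comp_eq_zero_iff.1 hcomp with h | ⟨-, h⟩
  · exact (hq.map (algebraMap k K)).ne_zero h
  · have hdeg := congrArg Polynomial.natDegree h
    rw [Polynomial.natDegree_C_mul_X_pow _ _ hdj, Polynomial.natDegree_C] at hdeg
    exact hN.ne' hdeg

/-- The simple objects `S_i(l x_i)` are nonzero. -/
theorem not_isZero_simpleSheaf (X : WeightedLine k) (i : Fin X.t) (l : ℕ) :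
    ¬ IsZero (X.simpleSheaf i l) := by
  intro h
  exact X.not_finite_quotSpan i ((ObjectProperty.SerreClassLocalization.isZero_obj_iff
    (qFunctor X.grading) (finDimFP X.grading) (X.cyclic i (l • X.xvec i))).1 h)

theorem restrQ_isEquivalence_iff (hH : Infinite H) :
    (restrQ X.grading H).IsEquivalence ↔ X.IsEffective H := by
  have hker := kernelSerre_eq_kernel hH
  constructor
  · intro hE i
    have : NeZero (X.p i) := ⟨(Nat.lt_of_succ_le (X.one_le_p i)).ne'⟩
    rw [eq_top_iff]
    rintro a -
    by_contra ha
    -- otherwise some nonzero `S_i(l x_i)` restricts to zero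
    have hl : -(((-a).val : ℕ) : ZMod (X.p i)) ∉ H.map (X.piHom i) := by
      rwa [ZMod.natCast_zmod_val, neg_neg]
    have hmem : X.kernelSerre H (X.simpleSheaf i (-a).val) :=
      fun Q _ hQ => hQ _ ⟨i, (-a).val, Nat.le_sub_one_of_lt (ZMod.val_lt _), hl, rfl⟩
    rw [hker] at hmem
    have hz : IsZero ((restrQ X.grading H).obj (X.simpleSheaf i (-a).val)) := hmem
    refine X.not_isZero_simpleSheaf i (-a).val ?_
    rw [IsZero.iff_id_eq_zero]
    apply (restrQ X.grading H).map_injective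
    exact hz.eq_of_src _ _
  · intro hE
    -- the generating family of `N_H` is empty
    have hbot : X.kernelSerre H ≤ IsZero := by
      intro Y hY
      refine hY _ inferInstance ?_
      rintro _ ⟨i, l, -, hl, -⟩
      exact absurd (by rw [hE i]; trivial) hl
    have := restrQ_isLocalization_kernelSerre hH
    have : (𝟭 (QMod X.grading)).IsLocalization (X.kernelSerre H).isoModSerre := by
      refine Functor.IsLocalization.for_id _ fun Y Z f hf => ?_
      have := Preadditive.mono_of_isZero_kernel f (hbot _ hf.1)
      have := Preadditive.epi_of_isZero_cokernel f (hbot _ hf.2)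
      exact isIso_of_mono_of_epi f
    exact Functor.isEquivalence_of_iso (Localization.compUniqFunctor (𝟭 _)
      (restrQ X.grading H) (X.kernelSerre H).isoModSerre)

end WeightedLine

theorem mainTheorem4 {k : Type u} [Field k] (X : WeightedLine k)
    (H : AddSubgroup X.StringGroup) (hH : Infinite H) :
    (∃ hN : (X.kernelSerre H).isoModSerre.IsInvertedBy (restrQ X.grading H),
      (Localization.Construction.lift (restrQ X.grading H) hN).IsEquivalence) ∧
    ((restrQ X.grading H).IsEquivalence ↔ X.IsEffective H) := by
  have h := WeightedLine.restrQ_isLocalization_kernelSerre hH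
  exact ⟨⟨h.inverts, h.isEquivalence⟩, WeightedLine.restrQ_isEquivalence_iff hH⟩
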